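/- **Setting.** Let $\mathcal T$ be the field of real transseries in $x\to+\infty$, i.e. finitely generated (grid-based) logarithmic-exponential transseries. Explicitly, level-$0$ transmonomials are the finite products $x^{a_0}(\log x)^{a_1}(\log\log x)^{a_2}\cdots$ with real exponents, ordered by asymptotic size. Level-$(n+1)$ transmonomials are $e^{\ell}$, where $\ell$ is a purely large series over level $n$; level $n$ is contained in level $n+1$ through $m=e^{\log m}$. Elements of $\mathcal T$ are formal sums $\sum_{\mathbf k\ge \mathbf k_0}c_{\mathbf k}\,\mu_1^{k_1}\cdots\mu_M^{k_M}$ with $c_{\mathbf k}\in\mathbb R$, finitely many transmonomials $\mu_1,\dots,\mu_M\ll 1$, and $\mathbf k_0\in\mathbb Z^M$. (Equivalently, $\mathcal T$ consists of the compositions $T\circ\log^{\circ m}$ of log-free transseries $T$ with iterated logarithms.) Differentiation is term by term, and $f\ll1$ means that every transmonomial occurring in $f$ is $\ll1$. An infinite sum of transseries is understood formally: all its terms are series over one common grid $\{\mu_1^{k_1}\cdots\mu_M^{k_M}:\mathbf k\ge\mathbf k_0\}$, each transmonomial occurs in only finitely many terms, and coefficients are added. Let $\beta\in\mathbb R$ and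 let $$F_0(x^{-1})=\sum_{k\ge2}\frac{F_{0k}}{x^k},\qquad g(x^{-1},f)=\sum_{k\ge0,\ l\ge1}g_{kl}\,x^{-k}f^l,\qquad g_{01}=g_{11}=0,$$ be formal power series with real coefficients (convergent or not). Consider, for $f\in\mathcal T$ with $f\ll1$, the equation $$f'=F_0(x^{-1})-f+\frac{\beta}{x}f-g(x^{-1},f).\tag{1}$$ **Proposition.** There are a formal power series $\tilde f_0=\sum_{j\ge2}c_jx^{-j}$ and formal power series $\tilde f_k=\sum_{j\ge0}f_{k;j}x^{-j}$, $k\ge1$, with real coefficients, such that: 1. $\tilde f_0$ is a solution of (1) with $\tilde f_0\ll1$, and it is the only solution $\ll 1$ of (1) among the transseries of level zero in the powers of $x$ (grid-based series in real powers of $x$), in particular among formal power series in $1/x$. 2. For every $C\in\mathbb R$ the formal sum $$\delta_C=\sum_{k=1}^\infty C^k x^{\beta k}e^{-kx}\tilde f_k(x)$$ exists in $\mathcal T$, and $C\mapsto\tilde f_0+\delta_C$ is a bijection from $\mathbb R$ onto the set of all solutions $f\in\mathcal T$, $f\ll1$, of (1). That is, the general small transseries solution of (1) is $\tilde f_0+\sum_{k\ge1}C^kx^{\beta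 k}e^{-kx}\tilde f_k(x)$, with $\tilde f_k$ not depending on $C$. -/

import Mathlib

/-!
# Grid-based transseries

Conventions.  A group of transmonomials is written additively, with reversed order: an exponent
`γ` stands for a transmonomial, `γ + δ` for the product, and `γ < δ` means that the transmonomial of
`γ` is asymptotically larger (`≫`) than that of `δ`.  So `0 < γ` says that the transmonomial is
small (`≪ 1`), and a formal series of transmonomials with real coefficients is a Hahn series.

The transmonomials of the field `𝒯` of (real, grid-based, logarithmic-exponential) transseries in
`x → +∞` are built in levels.  Level `0` consists of the products
`x ^ a₀ * (log x) ^ a₁ * (log log x) ^ a₂ * ⋯` (finitely many factors, real exponents).  Level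
`n + 1` consists of `exp ℓ` for all purely large finitely generated series `ℓ` over level `n`.
Level `n` sits inside level `n + 1` by `m = exp (log m)`.  `𝒯` is the set of finitely generated
series over the union of all levels.  As every series has finitely many generators, which involve
finitely many iterated logarithms, this is the set of all `T ∘ Lₘ`, where `Lₘ` is the `m`-fold
iterated logarithm and `T` is a log-free transseries, i.e. one that is obtained from the powers
`t ^ σ` by finitely many steps, each of which forms the transmonomials `t ^ σ * exp ℓ`
with `ℓ` purely large.
-/

open scoped Pointwise

noncomputable section

namespace TS

section Grid

variable {Γ : Type} [AddCommGroup Γ] [LinearOrder Γ]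

/-- A set of transmonomials is a grid if it lies in `{∏ μᵢ ^ kᵢ | k ≥ k₀}` for finitely many small
transmonomials `μᵢ` and a multi-index `k₀` of integers. -/
def IsGrid (s : Set Γ) : Prop :=
  ∃ (ι : Type) (_ : Fintype ι) (μ : ι → Γ) (k₀ : ι → ℤ),
    (∀ i, 0 < μ i) ∧ s ⊆ {γ | ∃ k : ι → ℤ, k₀ ≤ k ∧ γ = ∑ i, k i • μ i}

theorem IsGrid.mono {s t : Set Γ} (ht : IsGrid t) (h : s ⊆ t) : IsGrid s := by
  obtain ⟨ι, hι, μ, k₀, hμ, hs⟩ := ht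
  exact ⟨ι, hι, μ, k₀, hμ, h.trans hs⟩

theorem IsGrid.add {s t : Set Γ} (hs : IsGrid s) (ht : IsGrid t) : IsGrid (s + t) := by
  obtain ⟨ι, hι, μ, k₀, hμ, hs⟩ := hs
  obtain ⟨κ, hκ, ν, l₀, hν, ht⟩ := ht
  refine ⟨ι ⊕ κ, inferInstance, Sum.elim μ ν, Sum.elim k₀ l₀, ?_, ?_⟩
  · rintro (i | i)
    · exact hμ i
    · exact hν i
  · rintro _ ⟨a, ha, b, hb, rfl⟩
    obtain ⟨k, hk, rfl⟩ := hs ha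
    obtain ⟨l, hl, rfl⟩ := ht hb
    refine ⟨Sum.elim k l, ?_, by simp⟩
    rintro (i | i)
    · exact hk i
    · exact hl i

theorem IsGrid.union {s t : Set Γ} (hs : IsGrid s) (ht : IsGrid t) : IsGrid (s ∪ t) := by
  obtain ⟨ι, hι, μ, k₀, hμ, hs⟩ := hs
  obtain ⟨κ, hκ, ν, l₀, hν, ht⟩ := ht
  refine ⟨ι ⊕ κ, inferInstance, Sum.elim μ ν, Sum.elim (k₀ ⊓ 0) (l₀ ⊓ 0), ?_, ?_⟩
  · rintro (i | i)
    · exact hμ i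
    · exact hν i
  · rintro _ (ha | hb)
    · obtain ⟨k, hk, rfl⟩ := hs ha
      refine ⟨Sum.elim k 0, ?_, by simp⟩
      rintro (i | i)
      · exact inf_le_left.trans (hk i)
      · exact inf_le_right
    · obtain ⟨k, hk, rfl⟩ := ht hb
      refine ⟨Sum.elim 0 k, ?_, by simp⟩
      rintro (i | i)
      · exact inf_le_right
      · exact inf_le_left.trans (hk i)

theorem isGrid_empty : IsGrid (∅ : Set Γ) :=
  ⟨Empty, inferInstance, fun _ => 0, 0, fun i => i.elim, Set.empty_subset _⟩

theorem isGrid_singleton (γ : Γ) [IsOrderedAddMonoid Γ] : IsGrid ({γ} : Set Γ) := by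
  rcases lt_trichotomy γ 0 with h | h | h
  · refine ⟨Unit, inferInstance, fun _ => -γ, fun _ => -1, fun _ => by simpa using h, ?_⟩
    rintro _ rfl
    exact ⟨fun _ => -1, le_rfl, by simp⟩
  · refine ⟨Empty, inferInstance, fun _ => 0, 0, fun i => i.elim, ?_⟩
    rintro _ rfl
    exact ⟨0, le_rfl, by simp [h]⟩
  · refine ⟨Unit, inferInstance, fun _ => γ, fun _ => 1, fun _ => by simpa using h, ?_⟩
    rintro _ rfl
    exact ⟨fun _ => 1, le_rfl, by simp⟩

theorem isGrid_iUnion {ι : Type} [Fintype ι] {s : ι → Set Γ} (h : ∀ i, IsGrid (s i)) :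
    IsGrid (⋃ i, s i) := by
  classical
  have key : ∀ t : Finset ι, IsGrid (⋃ i ∈ t, s i) := by
    intro t
    induction t using Finset.induction_on with
    | empty => simpa using isGrid_empty
    | insert a t _ ih => rw [Finset.set_biUnion_insert]; exact (h a).union ih
  simpa using key Finset.univ

theorem IsGrid.image {Γ' : Type} [AddCommGroup Γ'] [LinearOrder Γ'] {s : Set Γ} (hs : IsGrid s)
    (j : Γ →+ Γ') (hj : StrictMono j) : IsGrid (j '' s) := by
  obtain ⟨ι, hι, μ, k₀, hμ, hs⟩ := hs
  refine ⟨ι, hι, j ∘ μ, k₀, fun i => by simpa using hj (hμ i), ?_⟩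
  rintro _ ⟨a, ha, rfl⟩
  obtain ⟨k, hk, rfl⟩ := hs ha
  exact ⟨k, hk, by simp⟩

end Grid

section Series

variable {Γ : Type} [AddCommGroup Γ] [LinearOrder Γ] [IsOrderedAddMonoid Γ]

/-- The algebra of finitely generated (grid-based) series over a group of transmonomials. -/
def gridSubalgebra (Γ : Type) [AddCommGroup Γ] [LinearOrder Γ] [IsOrderedAddMonoid Γ] :
    Subalgebra ℝ (HahnSeries Γ ℝ) where
  carrier := {f | IsGrid f.support}
  mul_mem' ha hb := (ha.add hb).mono HahnSeries.support_mul_subset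
  add_mem' {a b} ha hb := (ha.union hb).mono (HahnSeries.support_add_subset ..)
  algebraMap_mem' r := (isGrid_singleton 0).mono (by
    rw [HahnSeries.algebraMap_apply, HahnSeries.C_apply]
    exact HahnSeries.support_single_subset)

/-- The type of finitely generated series over a group of transmonomials. -/
def GridSeries (Γ : Type) [AddCommGroup Γ] [LinearOrder Γ] [IsOrderedAddMonoid Γ] : Type := gridSubalgebra Γ

instance : CommRing (GridSeries Γ) := inferInstanceAs (CommRing (gridSubalgebra Γ))

instance : Algebra ℝ (GridSeries Γ) := inferInstanceAs (Algebra ℝ (gridSubalgebra Γ))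

def GridSeries.mk (f : HahnSeries Γ ℝ) (hf : IsGrid f.support) : GridSeries Γ := ⟨f, hf⟩

/-- The underlying Hahn series. -/
def toHahn : GridSeries Γ →ₐ[ℝ] HahnSeries Γ ℝ := (gridSubalgebra Γ).val

@[simp]
theorem toHahn_mk (f : HahnSeries Γ ℝ) (hf : IsGrid f.support) :
    toHahn (GridSeries.mk f hf) = f := rfl

theorem toHahn_injective : Function.Injective (toHahn (Γ := Γ)) := Subtype.val_injective

theorem isGrid_support (f : GridSeries Γ) : IsGrid (toHahn f).support := f.2

/-- The series `c * m`, where `m` is the transmonomial of exponent `γ`. -/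
def monomial (γ : Γ) (c : ℝ) : GridSeries Γ :=
  .mk (HahnSeries.single γ c) ((isGrid_singleton γ).mono HahnSeries.support_single_subset)

@[simp]
theorem toHahn_monomial (γ : Γ) (c : ℝ) : toHahn (monomial γ c) = HahnSeries.single γ c := rfl

theorem exists_generators (lam : Γ →+ GridSeries Γ) (f : GridSeries Γ) :
    ∃ S : Set Γ, IsGrid S ∧ S.IsPWO ∧ ∀ γ ∈ (toHahn f).support, (toHahn (lam γ)).support ⊆ S := by
  obtain ⟨ι, hι, μ, k₀, hμ, hs⟩ := isGrid_support f
  refine ⟨⋃ i, (toHahn (lam (μ i))).support, isGrid_iUnion fun i => isGrid_support _, ?_, ?_⟩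
  · have := (Finset.isPWO_bUnion Finset.univ (f := fun i => (toHahn (lam (μ i))).support)).2
      fun i _ => (toHahn (lam (μ i))).isPWO_support
    simpa using this
  · intro γ hγ δ hδ
    obtain ⟨k, -, rfl⟩ := hs hγ
    by_contra hn
    simp only [Set.mem_iUnion, HahnSeries.mem_support, not_exists, not_not] at hn
    apply hδ
    let c : GridSeries Γ →+ ℝ :=
      (HahnSeries.coeff.addMonoidHom δ).comp (toHahn (Γ := Γ) : GridSeries Γ →+ HahnSeries Γ ℝ)
    change c (lam (∑ i, k i • μ i)) = 0
    rw [map_sum, map_sum]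
    refine Finset.sum_eq_zero fun i _ => ?_
    rw [map_zsmul, map_zsmul, show c (lam (μ i)) = 0 from hn i, smul_zero]

/-- The family of the terms `f_m * m * lam m`, with `m` ranging over all transmonomials: the
termwise derivative of `f`, if `lam m` is the logarithmic derivative of `m`. -/
def derivFamily (lam : Γ →+ GridSeries Γ) (f : GridSeries Γ) :
    HahnSeries.SummableFamily Γ ℝ Γ where
  toFun γ := HahnSeries.single γ ((toHahn f).coeff γ) * toHahn (lam γ)
  isPWO_iUnion_support' := by
    obtain ⟨S, -, hS, h⟩ := exists_generators lam f
    refine ((toHahn f).isPWO_support.add hS).mono (Set.iUnion_subset fun γ => ?_)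
    by_cases hγ : (toHahn f).coeff γ = 0
    · simp [hγ]
    · exact HahnSeries.support_mul_subset.trans (Set.add_subset_add
        (HahnSeries.support_single_subset.trans (by simpa using hγ)) (h γ hγ))
  finite_co_support' δ := by
    obtain ⟨S, -, hS, h⟩ := exists_generators lam f
    refine ((Finset.antidiagonal (toHahn f).isPWO_support hS δ).image Prod.fst).finite_toSet.subset ?_
    intro γ hγ
    have hγ : (HahnSeries.single γ ((toHahn f).coeff γ) * toHahn (lam γ)).coeff δ ≠ 0 := hγ
    rw [HahnSeries.coeff_single_mul] at hγ
    have h0 : γ ∈ (toHahn f).support := left_ne_zero_of_mul hγ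
    have h1 : δ - γ ∈ S := h γ h0 (right_ne_zero_of_mul hγ)
    simp only [Finset.coe_image, Set.mem_image, Finset.mem_coe, Finset.mem_antidiagonal]
    exact ⟨(γ, δ - γ), ⟨h0, h1, by simp⟩, rfl⟩

theorem isGrid_derivFamily (lam : Γ →+ GridSeries Γ) (f : GridSeries Γ) :
    IsGrid (derivFamily lam f).hsum.support := by
  obtain ⟨S, hg, hS, h⟩ := exists_generators lam f
  have hf := isGrid_support f
  refine (hf.add hg).mono ?_
  intro δ hδ
  rw [HahnSeries.mem_support, HahnSeries.SummableFamily.coeff_hsum] at hδ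
  obtain ⟨γ, hγ⟩ := not_forall.1 (mt finsum_eq_zero_of_forall_eq_zero hδ)
  have hγ : (HahnSeries.single γ ((toHahn f).coeff γ) * toHahn (lam γ)).coeff δ ≠ 0 := hγ
  rw [HahnSeries.coeff_single_mul] at hγ
  have h0 : γ ∈ (toHahn f).support := left_ne_zero_of_mul hγ
  exact ⟨γ, h0, δ - γ, h γ h0 (right_ne_zero_of_mul hγ), by simp⟩

/-- Term by term differentiation, for given logarithmic derivatives `lam` of the transmonomials:
`(∑ c_m m)' = ∑ c_m * m * lam m`. -/
def deriv (lam : Γ →+ GridSeries Γ) : GridSeries Γ →ₗ[ℝ] GridSeries Γ where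
  toFun f := .mk (derivFamily lam f).hsum (isGrid_derivFamily lam f)
  map_add' f g := by
    apply toHahn_injective
    change (derivFamily lam (f + g)).hsum = (derivFamily lam f).hsum + (derivFamily lam g).hsum
    rw [← HahnSeries.SummableFamily.hsum_add]
    congr 1
    ext1 γ
    simp [derivFamily, HahnSeries.SummableFamily.add_apply, add_mul]
  map_smul' c f := by
    apply toHahn_injective
    change (derivFamily lam (c • f)).hsum = c • (derivFamily lam f).hsum
    ext δ
    rw [HahnSeries.coeff_smul, HahnSeries.SummableFamily.coeff_hsum,
      HahnSeries.SummableFamily.coeff_hsum, smul_finsum]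
    congr 1
    ext γ
    change (HahnSeries.single γ (c * (toHahn f).coeff γ) * toHahn (lam γ)).coeff δ =
      c * (HahnSeries.single γ ((toHahn f).coeff γ) * toHahn (lam γ)).coeff δ
    rw [HahnSeries.coeff_single_mul, HahnSeries.coeff_single_mul, mul_assoc]

theorem deriv_monomial (lam : Γ →+ GridSeries Γ) (γ : Γ) (c : ℝ) :
    deriv lam (monomial γ c) = monomial γ c * lam γ := by
  apply toHahn_injective
  change (derivFamily lam (monomial γ c)).hsum = HahnSeries.single γ c * toHahn (lam γ)
  ext δ
  rw [HahnSeries.SummableFamily.coeff_hsum, finsum_eq_single _ γ]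
  · simp [derivFamily, monomial]
  · intro γ' h
    simp [derivFamily, monomial, HahnSeries.coeff_single_of_ne h]

variable {Γ' : Type} [AddCommGroup Γ'] [LinearOrder Γ'] [IsOrderedAddMonoid Γ']

/-- The map of series that is induced by an embedding of groups of transmonomials. -/
def gridMap (j : Γ →+ Γ') (hj : StrictMono j) : GridSeries Γ →ₐ[ℝ] GridSeries Γ' :=
  ((HahnSeries.embDomainAlgHom (R := ℝ) j hj.injective fun _ _ => hj.le_iff_le).comp
    toHahn).codRestrict (gridSubalgebra Γ') fun f =>
      ((isGrid_support f).image j hj).mono HahnSeries.support_embDomain_subset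

theorem gridMap_coeff (j : Γ →+ Γ') (hj : StrictMono j) (f : GridSeries Γ) (γ : Γ) :
    (toHahn (gridMap j hj f)).coeff (j γ) = (toHahn f).coeff γ :=
  HahnSeries.embDomain_coeff (f := ⟨⟨j, hj.injective⟩, hj.le_iff_le⟩)

theorem gridMap_coeff_of_notMem (j : Γ →+ Γ') (hj : StrictMono j) (f : GridSeries Γ) {γ : Γ'}
    (h : γ ∉ Set.range j) : (toHahn (gridMap j hj f)).coeff γ = 0 :=
  HahnSeries.embDomain_of_notMem_range (f := ⟨⟨j, hj.injective⟩, hj.le_iff_le⟩) h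

theorem gridMap_monomial (j : Γ →+ Γ') (hj : StrictMono j) (γ : Γ) (c : ℝ) :
    gridMap j hj (monomial γ c) = monomial (j γ) c :=
  toHahn_injective (HahnSeries.embDomain_single (f := ⟨⟨j, hj.injective⟩, hj.le_iff_le⟩))

theorem gridMap_gridMap {Γ'' : Type} [AddCommGroup Γ''] [LinearOrder Γ''] [IsOrderedAddMonoid Γ'']
    (j : Γ →+ Γ') (hj : StrictMono j) (k : Γ' →+ Γ'') (hk : StrictMono k)
    (l : Γ →+ Γ'') (hl : StrictMono l) (h : ∀ γ, k (j γ) = l γ) (f : GridSeries Γ) :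
    gridMap k hk (gridMap j hj f) = gridMap l hl f := by
  apply toHahn_injective
  ext δ
  by_cases h1 : δ ∈ Set.range k
  · obtain ⟨γ', rfl⟩ := h1
    rw [gridMap_coeff]
    by_cases h2 : γ' ∈ Set.range j
    · obtain ⟨γ, rfl⟩ := h2
      rw [gridMap_coeff, h, gridMap_coeff]
    · rw [gridMap_coeff_of_notMem j hj f h2, gridMap_coeff_of_notMem]
      rintro ⟨γ, hγ⟩
      exact h2 ⟨γ, hk.injective (by rw [h, hγ])⟩
  · rw [gridMap_coeff_of_notMem k hk _ h1, gridMap_coeff_of_notMem]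
    rintro ⟨γ, rfl⟩
    exact h1 ⟨j γ, h γ⟩

theorem deriv_gridMap (j : Γ →+ Γ') (hj : StrictMono j) (lam : Γ →+ GridSeries Γ)
    (lam' : Γ' →+ GridSeries Γ') (h : ∀ γ, lam' (j γ) = gridMap j hj (lam γ))
    (f : GridSeries Γ) : deriv lam' (gridMap j hj f) = gridMap j hj (deriv lam f) := by
  have key : ∀ γ δ, (derivFamily lam' (gridMap j hj f) (j γ)).coeff δ =
      (toHahn (gridMap j hj (monomial γ ((toHahn f).coeff γ) * lam γ))).coeff δ := by
    intro γ δ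
    rw [map_mul, ← h, gridMap_monomial]
    simp [derivFamily, monomial, gridMap_coeff]
  have key2 : ∀ δ, (toHahn (deriv lam' (gridMap j hj f))).coeff δ =
      ∑ᶠ γ, (toHahn (gridMap j hj (monomial γ ((toHahn f).coeff γ) * lam γ))).coeff δ := by
    intro δ
    change (derivFamily lam' (gridMap j hj f)).hsum.coeff δ = _
    rw [HahnSeries.SummableFamily.coeff_hsum, ← finsum_mem_univ,
      finsum_mem_inter_support_eq _ _ (Set.range j), finsum_mem_range hj.injective]
    · simp_rw [key]
    · ext γ
      simp only [Set.univ_inter, Set.mem_inter_iff, iff_and_self]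
      intro hγ
      by_contra hn
      apply hγ
      simp [derivFamily, gridMap_coeff_of_notMem j hj f hn]
  apply toHahn_injective
  ext δ
  rw [key2]
  by_cases hδ : δ ∈ Set.range j
  · obtain ⟨δ, rfl⟩ := hδ
    rw [gridMap_coeff]
    simp_rw [gridMap_coeff]
    change _ = (derivFamily lam f).hsum.coeff δ
    rw [HahnSeries.SummableFamily.coeff_hsum]
    rfl
  · rw [gridMap_coeff_of_notMem j hj _ hδ]
    simp_rw [gridMap_coeff_of_notMem j hj _ hδ]
    simp

end Series

section Large

variable {Γ : Type} [AddCommGroup Γ] [LinearOrder Γ] [IsOrderedAddMonoid Γ]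

/-- Purely large series: all the transmonomials that occur are large.  They are ordered by the sign
of the leading coefficient of the difference. -/
def largeSubgroup (Γ : Type) [AddCommGroup Γ] [LinearOrder Γ] [IsOrderedAddMonoid Γ] :
    AddSubgroup (Lex (HahnSeries Γ ℝ)) where
  carrier := {l | IsGrid (ofLex l).support ∧ ∀ γ ∈ (ofLex l).support, γ < 0}
  zero_mem' := by simpa using isGrid_empty
  add_mem' {a b} ha hb := by
    have h : (ofLex (a + b)).support ⊆ (ofLex a).support ∪ (ofLex b).support :=
      HahnSeries.support_add_subset ..
    exact ⟨(ha.1.union hb.1).mono h, fun γ hγ => (h hγ).elim (ha.2 γ) (hb.2 γ)⟩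
  neg_mem' {a} ha := by simpa using ha

/-- The ordered group of purely large series. -/
def Large (Γ : Type) [AddCommGroup Γ] [LinearOrder Γ] [IsOrderedAddMonoid Γ] : Type := largeSubgroup Γ

instance : AddCommGroup (Large Γ) := inferInstanceAs (AddCommGroup (largeSubgroup Γ))

instance : LinearOrder (Large Γ) := inferInstanceAs (LinearOrder (largeSubgroup Γ))

instance : IsOrderedAddMonoid (Large Γ) := inferInstanceAs (IsOrderedAddMonoid (largeSubgroup Γ))

def Large.mk (f : GridSeries Γ) (hf : ∀ γ ∈ (toHahn f).support, γ < 0) : Large Γ :=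
  ⟨toLex (toHahn f), isGrid_support f, hf⟩

/-- A purely large series as a series. -/
def Large.toGrid : Large Γ →+ GridSeries Γ where
  toFun l := .mk (ofLex l.1) l.2.1
  map_zero' := rfl
  map_add' _ _ := rfl

theorem Large.toGrid_mk (f : GridSeries Γ) (hf : ∀ γ ∈ (toHahn f).support, γ < 0) :
    (Large.mk f hf).toGrid = f := rfl

theorem Large.neg_of_mem_support (l : Large Γ) :
    ∀ γ ∈ (toHahn l.toGrid).support, γ < 0 := l.2.2

theorem Large.toGrid_injective : Function.Injective (Large.toGrid (Γ := Γ)) :=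
  fun _ _ h => Subtype.ext (congrArg toHahn h :)

theorem Large.lt_iff (a b : Large Γ) : a < b ↔ ∃ γ,
    (∀ δ < γ, (toHahn a.toGrid).coeff δ = (toHahn b.toGrid).coeff δ) ∧
      (toHahn a.toGrid).coeff γ < (toHahn b.toGrid).coeff γ :=
  HahnSeries.lt_iff a.1 b.1

variable {Γ' : Type} [AddCommGroup Γ'] [LinearOrder Γ'] [IsOrderedAddMonoid Γ']

/-- The map of purely large series that is induced by an embedding of transmonomials. -/
def Large.map (j : Γ →+ Γ') (hj : StrictMono j) : Large Γ →+ Large Γ' where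
  toFun l := .mk (gridMap j hj l.toGrid) (by
    intro γ hγ
    obtain ⟨δ, hδ, rfl⟩ := HahnSeries.support_embDomain_subset hγ
    have := hj (l.neg_of_mem_support δ hδ)
    rwa [map_zero] at this)
  map_zero' := by
    apply Large.toGrid_injective
    rw [Large.toGrid_mk, map_zero, map_zero, map_zero]
  map_add' a b := by
    apply Large.toGrid_injective
    simp only [map_add, Large.toGrid_mk]

theorem Large.toGrid_map (j : Γ →+ Γ') (hj : StrictMono j) (l : Large Γ) :
    (Large.map j hj l).toGrid = gridMap j hj l.toGrid := rfl

theorem Large.map_strictMono (j : Γ →+ Γ') (hj : StrictMono j) :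
    StrictMono (Large.map j hj) := fun _ _ h =>
  (HahnSeries.embDomainOrderEmbedding ⟨⟨j, hj.injective⟩, hj.le_iff_le⟩).strictMono h

end Large

/-- One level of the construction: a group `Mon` of transmonomials, their logarithmic derivatives
`m' / m`, and the negative logarithms `-log m`, which are purely large series. -/
structure Level where
  Mon : Type
  [addCommGroup : AddCommGroup Mon]
  [linearOrder : LinearOrder Mon]
  [isOrderedAddMonoid : IsOrderedAddMonoid Mon]
  logDeriv : Mon →+ GridSeries Mon
  negLog : Mon →+ Large Mon
  negLog_strictMono : StrictMono negLog
  deriv_negLog : ∀ m, deriv logDeriv (negLog m).toGrid = -logDeriv m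

attribute [instance] Level.addCommGroup Level.linearOrder Level.isOrderedAddMonoid

/-- The next level.  Its transmonomials are the `exp (-ℓ)` with `ℓ` purely large over `S`; it is `-ℓ`
that is exponentiated so that small transmonomials have positive exponents.  The logarithmic
derivative of `exp (-ℓ)` is `-ℓ'`.  A transmonomial `m` of `S` becomes `exp (-(-log m))`. -/
def Level.next (S : Level) : Level where
  Mon := Large S.Mon
  logDeriv := -((gridMap S.negLog S.negLog_strictMono).toLinearMap.toAddMonoidHom.comp
    ((deriv S.logDeriv).toAddMonoidHom.comp Large.toGrid))
  negLog := Large.map S.negLog S.negLog_strictMono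
  negLog_strictMono := Large.map_strictMono _ _
  deriv_negLog l := by
    rw [Large.toGrid_map, deriv_gridMap S.negLog S.negLog_strictMono S.logDeriv]
    · simp
    · intro m
      change -gridMap S.negLog S.negLog_strictMono (deriv S.logDeriv (Large.toGrid (S.negLog m))) = _
      rw [S.deriv_negLog, map_neg, neg_neg]

/-- The transmonomials of level `0`: `a` is the exponent of `∏ Lₖ ^ (-aₖ)`, where `L₀ = x` and
`Lₖ₊₁ = log Lₖ`.  The order is lexicographic, since `Lₖ` dominates every power of `Lₖ₊₁`. -/
def LogMon : Type := Lex (ℕ →₀ ℝ)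

instance : AddCommGroup LogMon := inferInstanceAs (AddCommGroup (Lex (ℕ →₀ ℝ)))

instance : LinearOrder LogMon := inferInstanceAs (LinearOrder (Lex (ℕ →₀ ℝ)))

instance : IsOrderedAddMonoid LogMon := inferInstanceAs (IsOrderedAddMonoid (Lex (ℕ →₀ ℝ)))

/-- The exponent of `∏ Lₖ ^ (-aₖ)`. -/
def LogMon.mk : (ℕ →₀ ℝ) ≃+ LogMon := toLexAddEquiv _

/-- The exponent of `1 / Lₖ`. -/
def logExp (k : ℕ) : LogMon := LogMon.mk (Finsupp.single k 1)

theorem LogMon.pos_iff (a : ℕ →₀ ℝ) : 0 < LogMon.mk a ↔ ∃ i, (∀ j < i, a j = 0) ∧ 0 < a i := by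
  refine (Finsupp.Lex.lt_iff (a := 0) (b := toLex a)).trans (exists_congr fun i => and_congr ?_ .rfl)
  exact forall_congr' fun j => forall_congr' fun _ => eq_comm

theorem logExp_pos (k : ℕ) : 0 < logExp k :=
  (LogMon.pos_iff _).2 ⟨k, fun _ hj => Finsupp.single_eq_of_ne hj.ne, by simp⟩

theorem logExp_strictAnti : StrictAnti logExp := fun j k h => by
  rw [← sub_pos, logExp, logExp, ← map_sub]
  refine (LogMon.pos_iff _).2 ⟨j, fun i hi => ?_, ?_⟩
  · simp [Finsupp.single_eq_of_ne hi.ne, Finsupp.single_eq_of_ne (hi.trans h).ne]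
  · simp [Finsupp.single_eq_of_ne h.ne]

/-- The purely large series `c * Lₖ`. -/
def iterLog (k : ℕ) : ℝ →+ Large LogMon where
  toFun c := .mk (monomial (-logExp k) c) fun γ hγ => by
    obtain rfl := HahnSeries.support_single_subset hγ
    simpa using logExp_pos k
  map_zero' := by
    apply Large.toGrid_injective
    apply toHahn_injective
    simp [Large.toGrid_mk]
  map_add' a b := by
    apply Large.toGrid_injective
    apply toHahn_injective
    simp [Large.toGrid_mk]

/-- `-log (∏ Lₖ ^ (-aₖ)) = ∑ aₖ Lₖ₊₁`. -/
def logMonNegLog : LogMon →+ Large LogMon :=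
  (Finsupp.liftAddHom fun k => iterLog (k + 1)).comp LogMon.mk.symm.toAddMonoidHom

/-- The logarithmic derivative `-∑ aₖ / (L₀ L₁ ⋯ Lₖ)` of `∏ Lₖ ^ (-aₖ)`. -/
def logMonLogDeriv : LogMon →+ GridSeries LogMon :=
  -(Finsupp.liftAddHom fun k => (AddMonoidHom.mulRight
    (monomial (∑ i ∈ Finset.range (k + 1), logExp i) 1)).comp
      (algebraMap ℝ (GridSeries LogMon)).toAddMonoidHom).comp LogMon.mk.symm.toAddMonoidHom

theorem coeff_logMonNegLog (a : ℕ →₀ ℝ) (γ : LogMon) :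
    (toHahn (logMonNegLog (.mk a)).toGrid).coeff γ =
      a.sum fun k c => (HahnSeries.single (-logExp (k + 1)) c).coeff γ := by
  let φ : Large LogMon →+ ℝ := (HahnSeries.coeff.addMonoidHom γ).comp
    ((toHahn (Γ := LogMon) : GridSeries LogMon →+ HahnSeries LogMon ℝ).comp Large.toGrid)
  change φ (Finsupp.liftAddHom (fun k => iterLog (k + 1)) a) = _
  rw [Finsupp.liftAddHom_apply, map_finsuppSum]
  rfl

theorem logMonNegLog_strictMono : StrictMono logMonNegLog := by
  refine (strictMono_iff_map_pos logMonNegLog).2 fun a ha => ?_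
  obtain ⟨a, rfl⟩ := LogMon.mk.surjective a
  obtain ⟨i, hi, hpos⟩ := (LogMon.pos_iff a).1 ha
  refine (Large.lt_iff _ _).2 ⟨-logExp (i + 1), fun γ hγ => ?_, ?_⟩
  · rw [map_zero, map_zero, HahnSeries.coeff_zero, coeff_logMonNegLog, Finsupp.sum,
      Finset.sum_eq_zero]
    intro k hk
    by_cases h : γ = -logExp (k + 1)
    · subst h
      rw [neg_lt_neg_iff, logExp_strictAnti.lt_iff_gt] at hγ
      exact absurd (hi k (by omega)) (Finsupp.mem_support_iff.1 hk)
    · exact HahnSeries.coeff_single_of_ne h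
  · rw [map_zero, map_zero, HahnSeries.coeff_zero, coeff_logMonNegLog, Finsupp.sum,
      Finset.sum_eq_single i]
    · simpa using hpos
    · intro k _ hk
      apply HahnSeries.coeff_single_of_ne
      intro h
      rw [neg_inj] at h
      rcases lt_or_gt_of_ne hk with h' | h'
      · exact (logExp_strictAnti (Nat.succ_lt_succ h')).ne h
      · exact (logExp_strictAnti (Nat.succ_lt_succ h')).ne' h
    · intro h
      simp [Finsupp.notMem_support_iff.1 h]

theorem logMonLogDeriv_logExp (k : ℕ) :
    logMonLogDeriv (logExp k) = -monomial (∑ i ∈ Finset.range (k + 1), logExp i) 1 := by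
  simp [logMonLogDeriv, logExp]

theorem logMonLogDeriv_mk (a : ℕ →₀ ℝ) : logMonLogDeriv (.mk a) =
    -a.sum fun k c => algebraMap ℝ (GridSeries LogMon) c *
      monomial (∑ i ∈ Finset.range (k + 1), logExp i) 1 := rfl

/-- Level `0`: the monomials in the iterated logarithms of `x`. -/
def Level.zero : Level where
  Mon := LogMon
  logDeriv := logMonLogDeriv
  negLog := logMonNegLog
  negLog_strictMono := logMonNegLog_strictMono
  deriv_negLog a := by
    obtain ⟨a, rfl⟩ := LogMon.mk.surjective a
    let φ : Large LogMon →+ GridSeries LogMon :=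
      (deriv logMonLogDeriv).toAddMonoidHom.comp Large.toGrid
    change φ (Finsupp.liftAddHom (fun k => iterLog (k + 1)) a) = _
    rw [logMonLogDeriv_mk, neg_neg, Finsupp.liftAddHom_apply, map_finsuppSum]
    refine Finsupp.sum_congr fun k _ => ?_
    change deriv logMonLogDeriv (monomial (-logExp (k + 1)) _) = _
    rw [deriv_monomial, map_neg, logMonLogDeriv_logExp, neg_neg]
    apply toHahn_injective
    change HahnSeries.single (-logExp (k + 1)) (a k) *
        HahnSeries.single (∑ i ∈ Finset.range (k + 2), logExp i) (1 : ℝ) =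
      HahnSeries.single (0 : LogMon) (a k) *
        HahnSeries.single (∑ i ∈ Finset.range (k + 1), logExp i) (1 : ℝ)
    rw [HahnSeries.single_mul_single, HahnSeries.single_mul_single, Finset.sum_range_succ,
      zero_add, neg_add_cancel_comm_assoc]

/-- The levels. -/
def level : ℕ → Level
  | 0 => Level.zero
  | n + 1 => (level n).next

/-- The transmonomials of level `n`. -/
abbrev Mon (n : ℕ) : Type := (level n).Mon

/-- The inclusion of level `n` in level `n + 1`, `m = exp (log m)`. -/
def stepMap (n : ℕ) : Mon n →+ Mon (n + 1) := (level n).negLog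

theorem stepMap_strictMono (n : ℕ) : StrictMono (stepMap n) := (level n).negLog_strictMono

theorem logDeriv_stepMap (n : ℕ) (m : Mon n) : (level (n + 1)).logDeriv (stepMap n m) =
    gridMap (stepMap n) (stepMap_strictMono n) ((level n).logDeriv m) := by
  change -gridMap (level n).negLog (level n).negLog_strictMono
    (deriv (level n).logDeriv (Large.toGrid ((level n).negLog m))) = _
  rw [(level n).deriv_negLog, map_neg, neg_neg]
  rfl

/-- The inclusion of level `i` in level `j`. -/
def trans (i j : ℕ) (h : i ≤ j) : Mon i →+ Mon j :=
  Nat.leRec (motive := fun k _ => Mon i →+ Mon k) (AddMonoidHom.id _)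
    (fun k _ f => (stepMap k).comp f) h

theorem trans_self (i : ℕ) : trans i i le_rfl = AddMonoidHom.id _ := by
  rw [trans, Nat.leRec_self]

theorem trans_succ (i j : ℕ) (h : i ≤ j) :
    trans i (j + 1) (h.trans j.le_succ) = (stepMap j).comp (trans i j h) := by
  rw [trans, Nat.leRec_succ]
  rfl

theorem trans_strictMono (i j : ℕ) (h : i ≤ j) : StrictMono (trans i j h) := by
  induction j, h using Nat.le_induction with
  | base => rw [trans_self]; exact strictMono_id
  | succ j h ih => rw [trans_succ i j h]; exact (stepMap_strictMono j).comp ih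

instance : DirectedSystem Mon (fun i j h => trans i j h) where
  map_self i x := by rw [trans_self]; rfl
  map_map k j i hij hjk x := by
    induction k, hjk using Nat.le_induction with
    | base => rw [trans_self]; rfl
    | succ k h ih =>
      rw [trans_succ j k h, trans_succ i k (hij.trans h)]
      exact congrArg (stepMap k) ih

/-- The group of all transmonomials, the union of the levels. -/
def Transmonomial : Type := DirectLimit Mon trans

instance : AddCommGroup Transmonomial := inferInstanceAs (AddCommGroup (DirectLimit Mon trans))

/-- The transmonomials of level `n` as transmonomials. -/
def ofLevel (n : ℕ) : Mon n →+ Transmonomial where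
  toFun m := (⟦⟨n, m⟩⟧ : DirectLimit Mon trans)
  map_zero' := (DirectLimit.zero_def n).symm
  map_add' a b := (DirectLimit.add_def n a b).symm

theorem exists_ofLevel (m : Transmonomial) : ∃ n a, m = ofLevel n a :=
  DirectLimit.exists_eq_mk (f := trans) m

theorem exists_ofLevel₂ (m m' : Transmonomial) : ∃ n a b, m = ofLevel n a ∧ m' = ofLevel n b :=
  DirectLimit.exists_eq_mk₂ trans m m'

theorem ofLevel_trans (i j : ℕ) (h : i ≤ j) (a : Mon i) : ofLevel j (trans i j h a) = ofLevel i a :=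
  DirectLimit.mk_apply (f := trans) i j a h

theorem ofLevel_stepMap (n : ℕ) (a : Mon n) : ofLevel (n + 1) (stepMap n a) = ofLevel n a := by
  have h := ofLevel_trans n (n + 1) n.le_succ a
  rwa [trans_succ n n le_rfl, trans_self] at h

theorem ofLevel_injective (n : ℕ) : Function.Injective (ofLevel n) :=
  DirectLimit.mk_injective trans (fun i j h => (trans_strictMono i j h).injective) n

/-- The transmonomials that are small or equal to `1`; the order is that of the levels. -/
def transmonomialCone : AddGroupCone Transmonomial where
  carrier := {m | ∃ n a, 0 ≤ a ∧ m = ofLevel n a}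
  zero_mem' := ⟨0, 0, le_rfl, (map_zero _).symm⟩
  add_mem' := by
    rintro _ _ ⟨i, a, ha, rfl⟩ ⟨j, b, hb, rfl⟩
    have h1 := (trans_strictMono i _ (le_max_left i j)).monotone ha
    have h2 := (trans_strictMono j _ (le_max_right i j)).monotone hb
    rw [map_zero] at h1 h2
    exact ⟨_, _, add_nonneg h1 h2, by rw [map_add, ofLevel_trans, ofLevel_trans]⟩
  eq_zero_of_mem_of_neg_mem' := by
    rintro _ ⟨i, a, ha, rfl⟩ ⟨j, b, hb, h⟩
    have h1 := (trans_strictMono i _ (le_max_left i j)).monotone ha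
    have h2 := (trans_strictMono j _ (le_max_right i j)).monotone hb
    rw [map_zero] at h1 h2
    rw [← ofLevel_trans i _ (le_max_left i j), ← ofLevel_trans j _ (le_max_right i j),
      ← map_neg] at h
    rw [← ofLevel_injective _ h] at h2
    rw [← ofLevel_trans i _ (le_max_left i j), le_antisymm (neg_nonneg.1 h2) h1, map_zero]

instance : HasMemOrNegMem transmonomialCone where
  mem_or_neg_mem m := by
    obtain ⟨n, a, rfl⟩ := exists_ofLevel m
    rcases le_total 0 a with h | h
    · exact .inl ⟨n, a, h, rfl⟩
    · exact .inr ⟨n, -a, neg_nonneg.2 h, (map_neg _ _).symm⟩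

open Classical in
instance : LinearOrder Transmonomial := LinearOrder.mkOfAddGroupCone transmonomialCone

instance : IsOrderedAddMonoid Transmonomial := IsOrderedAddMonoid.mkOfCone transmonomialCone

theorem ofLevel_strictMono (n : ℕ) : StrictMono (ofLevel n) := by
  refine Monotone.strictMono_of_injective (fun a b h => ?_) (ofLevel_injective n)
  exact ⟨n, b - a, sub_nonneg.2 h, (map_sub _ _ _).symm⟩

/-- Series over level `n` as series over all transmonomials. -/
def levelMap (n : ℕ) : GridSeries (Mon n) →ₐ[ℝ] GridSeries Transmonomial :=
  gridMap (ofLevel n) (ofLevel_strictMono n)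

theorem levelMap_logDeriv_trans (i j : ℕ) (h : i ≤ j) (a : Mon i) :
    levelMap i ((level i).logDeriv a) = levelMap j ((level j).logDeriv (trans i j h a)) := by
  induction j, h using Nat.le_induction with
  | base => rw [trans_self]; rfl
  | succ j h ih =>
    rw [ih, trans_succ i j h, AddMonoidHom.comp_apply, logDeriv_stepMap]
    exact (gridMap_gridMap _ _ _ _ _ _ (ofLevel_stepMap j) _).symm

/-- The logarithmic derivatives `m' / m` of all transmonomials. -/
def logDeriv : Transmonomial →+ GridSeries Transmonomial where
  toFun := DirectLimit.lift trans (fun n a => levelMap n ((level n).logDeriv a))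
    levelMap_logDeriv_trans
  map_zero' := by
    rw [← map_zero (ofLevel 0)]
    change levelMap 0 ((level 0).logDeriv 0) = 0
    rw [map_zero, map_zero]
  map_add' m m' := by
    obtain ⟨n, a, b, rfl, rfl⟩ := exists_ofLevel₂ m m'
    rw [← map_add]
    change levelMap n ((level n).logDeriv (a + b)) =
      levelMap n ((level n).logDeriv a) + levelMap n ((level n).logDeriv b)
    rw [map_add, map_add]

theorem logDeriv_ofLevel (n : ℕ) (a : Mon n) :
    logDeriv (ofLevel n a) = levelMap n ((level n).logDeriv a) := rfl

/-- The space `𝒯` of transseries in `x → +∞` with real coefficients. -/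
abbrev Transseries : Type := GridSeries Transmonomial

/-- Differentiation of transseries with respect to `x`. -/
def D : Transseries →ₗ[ℝ] Transseries := deriv logDeriv

/-- The transmonomials of level `0` as transmonomials. -/
def ofLogMon : LogMon →+ Transmonomial := ofLevel 0

/-- The transmonomial `exp (-ℓ)`, for `ℓ` purely large over level `0`. -/
def expNeg : Large LogMon →+ Transmonomial := ofLevel 1

theorem expNeg_logMonNegLog (a : LogMon) : expNeg (logMonNegLog a) = ofLogMon a :=
  ofLevel_stepMap 0 a

/-- The transmonomial `x ^ a`. -/
def powMon : ℝ →+ Transmonomial :=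
  -(ofLogMon.comp (LogMon.mk.toAddMonoidHom.comp (Finsupp.singleAddHom 0)))

/-- The transmonomial `exp (c * x)`. -/
def expMon : ℝ →+ Transmonomial := -(expNeg.comp (iterLog 0))

theorem powMon_strictAnti : StrictAnti powMon := by
  intro a b h
  change -ofLevel 0 (LogMon.mk (Finsupp.single 0 b) : LogMon) <
    -ofLevel 0 (LogMon.mk (Finsupp.single 0 a) : LogMon)
  refine neg_lt_neg (ofLevel_strictMono 0 ?_)
  change LogMon.mk (Finsupp.single 0 a) < LogMon.mk (Finsupp.single 0 b)
  rw [← sub_pos, ← map_sub]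
  exact (LogMon.pos_iff _).2 ⟨0, by simp, by simpa using h⟩

/-- The transseries `x ^ a`. -/
def xpow (a : ℝ) : Transseries := monomial (powMon a) 1

/-- The transseries `exp (c * x)`. -/
def expx (c : ℝ) : Transseries := monomial (expMon c) 1

/-- The transseries `p(1/x) = ∑ pₖ x ^ (-k)`, for a formal power series `p`. -/
def ofPowerSeries (p : PowerSeries ℝ) : Transseries :=
  .mk (HahnSeries.embDomain (OrderEmbedding.ofStrictMono (fun k : ℕ => powMon (-k))
      fun j k h => powMon_strictAnti (neg_lt_neg (Nat.cast_lt.2 h)))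
    (HahnSeries.toPowerSeries.symm p)) (by
    refine IsGrid.mono ⟨Unit, inferInstance, fun _ => powMon (-1), 0, fun _ => ?_, ?_⟩
      HahnSeries.support_embDomain_subset
    · have := powMon_strictAnti (show (-1 : ℝ) < 0 by norm_num)
      rwa [map_zero] at this
    · rintro _ ⟨k, -, rfl⟩
      refine ⟨fun _ => k, fun _ => Int.natCast_nonneg k, ?_⟩
      change powMon (-k) = _
      simp [← map_nsmul])

/-- `f ≪ 1`: all the transmonomials in `f` are small. -/
def IsSmall (f : Transseries) : Prop := ∀ m ∈ (toHahn f).support, 0 < m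

/-- Transseries of level `0` in the powers of `x`: all the transmonomials in `f` are powers `x ^ a`. -/
def IsLevelZero (f : Transseries) : Prop := ∀ m ∈ (toHahn f).support, ∃ a : ℝ, m = powMon a

/-- `f = ∑ uᵢ` in the topology of transseries: all the `uᵢ` are series over a common grid, each
transmonomial occurs in finitely many of them, and coefficients are added. -/
def HasFormalSum {ι : Type} (u : ι → Transseries) (f : Transseries) : Prop :=
  IsGrid (⋃ i, (toHahn (u i)).support) ∧
    ∃ s : HahnSeries.SummableFamily Transmonomial ℝ ι, (∀ i, s i = toHahn (u i)) ∧ s.hsum = toHahn f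

/-- `f` is a transseries solution, with `f ≪ 1`, of
`f' = F₀(1/x) - f + (β/x) f - g(1/x, f)`, where `g(1/x, f) = ∑ g_{kl} x ^ (-k) f ^ l`. -/
structure IsSmallSolution (β : ℝ) (F₀ : PowerSeries ℝ) (g : ℕ → ℕ → ℝ) (f : Transseries) : Prop where
  small : IsSmall f
  equation : ∃ G : Transseries,
    HasFormalSum (fun p : ℕ × ℕ => g p.1 p.2 • (xpow (-p.1) * f ^ p.2)) G ∧
      D f = ofPowerSeries F₀ - f + β • (xpow (-1) * f) - G

end TS

end

/-! Uniqueness. Let `h` be the difference of two small solutions. It satisfies `h' = -h + (β/x) h -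
(g(1/x, f) - g(1/x, φ))`, where everything after `-h` is `o(h)`. Hence the dominant transmonomial
`m` of `h` satisfies `m' ≍ m`, which forces `m` to lie beyond all powers of `1/x` (`lt_isLead_sub`).
As one solution is `O(x ^ (-2))`, all small solutions are. Now `g₀₁ = g₁₁ = 0` improves the
nonlinear difference to `O(x ^ (-2) h)`. So `u = x ^ (-β) e ^ x h` satisfies `u' = O(x ^ (-2) u)`.
But a transmonomial other than `1` has a logarithmic derivative that dominates `x ^ (-2)`, so the
dominant transmonomial of `u` is `1` (`isLead_sub_eq`). A small solution is therefore determined by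
its coefficient at `x ^ β e ^ (-x)`.

Both arguments rest on the valuation of logarithmic derivatives. The axioms `IsAsymptotic` of an
asymptotic couple make differentiation compatible with domination (`isLead_deriv`). They hold for
all transmonomials (`logDeriv_isAsymptotic`), by induction on the levels; the induction also carries
`log m ≪ m` for large `m`.

Existence. Take `f = ∑ c k j (x ^ β e ^ (-x)) ^ k x ^ (-j)` and compare coefficients. At `(k, j)`
the equation reads `(1 - k) c k j = [k = 0] F₀ⱼ + ((j - 1) + (1 - k) β) c k (j - 1) - G k j`, with
`G` the coefficients of `g(1/x, f)`. For `k ≠ 1` this is a recursion along the lexicographic order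
of `(k, j)`. For `k = 1` the left side vanishes, the equation determines `c 1 (j - 1)` for `j ≥ 2`,
and `c 1 0` is free (`exists_formal_solution`). Take `c 1 0 = 1`. Multiplying each coefficient with
`C ^ k` respects products and derivatives and fixes the power series in `1/x`, so one solution
yields the whole family (`isSmallSolution_ser`), whose coefficient at `x ^ β e ^ (-x)` is `C`. -/

noncomputable section

namespace TS

set_option linter.unusedSectionVars false

/-! ### Dominant transmonomials and asymptotic couples -/

section Asymptotic

variable {Γ : Type} [AddCommGroup Γ] [LinearOrder Γ] [IsOrderedAddMonoid Γ]

/-- `a` is the exponent of the dominant transmonomial of `f`. -/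
def IsLead (f : HahnSeries Γ ℝ) (a : Γ) : Prop := f.coeff a ≠ 0 ∧ ∀ b < a, f.coeff b = 0

theorem isLead_order {f : HahnSeries Γ ℝ} (hf : f ≠ 0) : IsLead f f.order :=
  ⟨fun h => hf (HahnSeries.coeff_order_eq_zero.1 h),
    fun _ => HahnSeries.coeff_eq_zero_of_lt_order⟩

theorem exists_isLead {f : HahnSeries Γ ℝ} (hf : f ≠ 0) : ∃ a, IsLead f a := ⟨_, isLead_order hf⟩

theorem IsLead.ne_zero {f : HahnSeries Γ ℝ} {a : Γ} (h : IsLead f a) : f ≠ 0 := by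
  rintro rfl
  exact h.1 rfl

theorem IsLead.unique {f : HahnSeries Γ ℝ} {a b : Γ} (ha : IsLead f a) (hb : IsLead f b) :
    a = b := by
  rcases lt_trichotomy a b with h | h | h
  · exact absurd (hb.2 a h) ha.1
  · exact h
  · exact absurd (ha.2 b h) hb.1

theorem IsLead.order_eq {f : HahnSeries Γ ℝ} {a : Γ} (h : IsLead f a) : f.order = a :=
  (isLead_order h.ne_zero).unique h

theorem IsLead.le {f : HahnSeries Γ ℝ} {a b : Γ} (h : IsLead f a) (hb : f.coeff b ≠ 0) : a ≤ b :=
  not_lt.1 fun hlt => hb (h.2 b hlt)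

theorem IsLead.neg {f : HahnSeries Γ ℝ} {a : Γ} (h : IsLead f a) : IsLead (-f) a :=
  ⟨by simpa using h.1, fun b hb => by simp [h.2 b hb]⟩

theorem IsLead.gridMap {Γ' : Type} [AddCommGroup Γ'] [LinearOrder Γ'] [IsOrderedAddMonoid Γ']
    {f : GridSeries Γ} {a : Γ} (h : IsLead (toHahn f) a) (j : Γ →+ Γ') (hj : StrictMono j) :
    IsLead (toHahn (gridMap j hj f)) (j a) := by
  refine ⟨by rw [gridMap_coeff]; exact h.1, fun b hb => ?_⟩
  by_cases hr : b ∈ Set.range j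
  · obtain ⟨b, rfl⟩ := hr
    rw [gridMap_coeff]
    exact h.2 b (hj.lt_iff_lt.1 hb)
  · exact gridMap_coeff_of_notMem j hj f hr

theorem toHahn_ne_zero {f : GridSeries Γ} (hf : f ≠ 0) : toHahn f ≠ 0 := fun h =>
  hf (toHahn_injective (by rw [h, map_zero]))

theorem coeff_deriv (lam : Γ →+ GridSeries Γ) (f : GridSeries Γ) (δ : Γ) :
    (toHahn (deriv lam f)).coeff δ =
      ∑ᶠ γ, (toHahn f).coeff γ * (toHahn (lam γ)).coeff (δ - γ) := by
  change (derivFamily lam f).hsum.coeff δ = _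
  rw [HahnSeries.SummableFamily.coeff_hsum]
  exact finsum_congr fun γ => HahnSeries.coeff_single_mul

theorem finite_support_coeff_deriv (lam : Γ →+ GridSeries Γ) (f : GridSeries Γ) (δ : Γ) :
    (Function.support fun γ =>
      (toHahn f).coeff γ * (toHahn (lam γ)).coeff (δ - γ)).Finite := by
  refine ((derivFamily lam f).finite_co_support δ).subset fun γ hγ => ?_
  change (HahnSeries.single γ ((toHahn f).coeff γ) * toHahn (lam γ)).coeff δ ≠ 0
  rwa [HahnSeries.coeff_single_mul]

/-- The exponent of the dominant transmonomial of the logarithmic derivative of `a`. -/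
def psi (lam : Γ →+ GridSeries Γ) (a : Γ) : Γ := (toHahn (lam a)).order

/-- The logarithmic derivatives form an asymptotic couple: only `1` has the derivative `0`, and the
derivative of a small transmonomial is dominated by all logarithmic derivatives. -/
structure IsAsymptotic (lam : Γ →+ GridSeries Γ) : Prop where
  ne_zero : ∀ a, a ≠ 0 → lam a ≠ 0
  psi_lt : ∀ a b, 0 < a → b ≠ 0 → psi lam b < a + psi lam a

theorem psi_neg (lam : Γ →+ GridSeries Γ) (a : Γ) : psi lam (-a) = psi lam a := by
  rw [psi, psi, map_neg, map_neg, HahnSeries.order_neg]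

namespace IsAsymptotic

variable {lam : Γ →+ GridSeries Γ} (h : IsAsymptotic lam)
include h

theorem isLead {a : Γ} (ha : a ≠ 0) : IsLead (toHahn (lam a)) (psi lam a) :=
  isLead_order (toHahn_ne_zero (h.ne_zero a ha))

theorem psi_sub {a b : Γ} (ha : a ≠ 0) (hb : b ≠ 0) (hab : psi lam a < psi lam b) :
    psi lam (a - b) = psi lam a := by
  refine IsLead.order_eq ?_
  rw [map_sub, map_sub]
  refine ⟨?_, fun c hc => ?_⟩
  · rw [HahnSeries.coeff_sub, (h.isLead hb).2 _ hab, sub_zero]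
    exact (h.isLead ha).1
  · rw [HahnSeries.coeff_sub, (h.isLead hb).2 _ (hc.trans hab), (h.isLead ha).2 _ hc, sub_zero]

/-- If the two values of `psi` differ, then `psi` of `b - a` is the smaller one, and the axiom for
the small transmonomial `b - a` bounds the larger one. -/
theorem psi_sub_psi_lt {a b : Γ} (ha : a ≠ 0) (hb : b ≠ 0) (hab : a < b) :
    psi lam a - psi lam b < b - a ∧ psi lam b - psi lam a < b - a := by
  have hpos : 0 < b - a := sub_pos.2 hab
  rcases lt_trichotomy (psi lam a) (psi lam b) with hlt | heq | hgt
  · have h1 := h.psi_lt (b - a) b hpos hb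
    rw [← neg_sub a b, psi_neg, h.psi_sub ha hb hlt, neg_sub] at h1
    exact ⟨(sub_neg.2 hlt).trans hpos, sub_lt_iff_lt_add.2 h1⟩
  · rw [heq, sub_self]
    exact ⟨hpos, hpos⟩
  · have h1 := h.psi_lt (b - a) a hpos ha
    rw [h.psi_sub hb ha hgt] at h1
    exact ⟨sub_lt_iff_lt_add.2 h1, (sub_neg.2 hgt).trans hpos⟩

/-- Since `psi` varies less than its argument, `a ↦ a + psi a`, the passage from a transmonomial to
the dominant term of its derivative, preserves the strict order. -/
theorem add_psi_lt {a b : Γ} (ha : a ≠ 0) (hb : b ≠ 0) (hab : a < b) :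
    a + psi lam a < b + psi lam b := by
  have := (h.psi_sub_psi_lt ha hb hab).1
  rw [sub_lt_iff_lt_add] at this
  calc a + psi lam a < a + (b - a + psi lam b) := by gcongr
    _ = b + psi lam b := by abel

/-- Differentiation respects domination. -/
theorem isLead_deriv {f : GridSeries Γ} {a : Γ} (hf : IsLead (toHahn f) a) (ha : a ≠ 0) :
    IsLead (toHahn (deriv lam f)) (a + psi lam a) := by
  -- Only `a` contributes up to the exponent `a + psi a`: smaller exponents do not occur in `f`,
  -- larger ones have derivatives of larger exponent, and the derivative of `1` is `0`.
  have key : ∀ γ δ, γ ≠ a → δ ≤ a + psi lam a →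
      (toHahn f).coeff γ * (toHahn (lam γ)).coeff (δ - γ) = 0 := by
    intro γ δ hγ hδ
    rcases lt_or_gt_of_ne hγ with hlt | hgt
    · rw [hf.2 γ hlt, zero_mul]
    · by_cases h0 : γ = 0
      · simp [h0]
      · rw [(h.isLead h0).2, mul_zero]
        rw [sub_lt_iff_lt_add']
        exact hδ.trans_lt (h.add_psi_lt ha h0 hgt)
  constructor
  · rw [coeff_deriv, finsum_eq_single _ a fun γ hγ => key γ _ hγ le_rfl, add_sub_cancel_left]
    exact mul_ne_zero hf.1 (h.isLead ha).1
  · intro δ hδ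
    rw [coeff_deriv, finsum_eq_zero_of_forall_eq_zero fun γ => ?_]
    by_cases hγ : γ = a
    · subst hγ
      rw [(h.isLead ha).2 _ (sub_lt_iff_lt_add'.2 hδ), mul_zero]
    · exact key γ δ hγ hδ.le

/-- A small transmonomial `m` with `m' ≍ m` is smaller than all powers of any `n` with `n' ≍ n²`. -/
theorem nsmul_lt_of_psi_eq_zero {e : Γ} (he : 0 < e) (hpe : psi lam e = e) {γ : Γ}
    (hγ : 0 < γ) (hpγ : psi lam γ = 0) (n : ℕ) : n • e < γ := by
  induction n with
  | zero => simpa using hγ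
  | succ n ih =>
    have hsm : ∀ m : ℕ, psi lam ((m + 1) • e) = e := fun m => by
      refine IsLead.order_eq ?_
      have := h.isLead he.ne'
      rw [hpe] at this
      rw [map_nsmul, map_nsmul]
      refine ⟨?_, fun b hb => ?_⟩
      · rw [HahnSeries.coeff_smul]
        exact smul_ne_zero m.succ_ne_zero this.1
      · rw [HahnSeries.coeff_smul, this.2 b hb, smul_zero]
    have hne : (n + 1) • e ≠ 0 := (nsmul_pos he n.succ_ne_zero).ne'
    by_contra hle
    rcases (not_lt.1 hle).lt_or_eq with hlt | heq
    -- Here `(n + 1) • e - γ` is positive with `psi` equal to `0`, so the axiom gives `e < (n + 1) •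
    -- e - γ`, that is `γ < n • e`, against the induction hypothesis.
    · have h1 : psi lam (γ - (n + 1) • e) = 0 := by
        rw [h.psi_sub hγ.ne' hne (by rw [hpγ, hsm]; exact he), hpγ]
      have h2 := h.psi_lt ((n + 1) • e - γ) e (sub_pos.2 hlt) he.ne'
      rw [← neg_sub γ, psi_neg, h1, hpe, add_zero, neg_sub, lt_sub_iff_add_lt, succ_nsmul,
        add_comm, add_lt_add_iff_right] at h2
      exact lt_asymm ih h2
    · rw [heq, hsm] at hpγ
      exact he.ne' hpγ

end IsAsymptotic

theorem finite_support_coeff_mul (f g : HahnSeries Γ ℝ) (δ : Γ) :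
    (Function.support fun γ => f.coeff γ * g.coeff (δ - γ)).Finite := by
  refine ((Finset.antidiagonal f.isPWO_support g.isPWO_support δ).image
    Prod.fst).finite_toSet.subset fun γ hγ => ?_
  rw [Finset.coe_image]
  refine ⟨(γ, δ - γ), ?_, rfl⟩
  rw [Finset.mem_coe, Finset.mem_antidiagonal]
  exact ⟨left_ne_zero_of_mul hγ, right_ne_zero_of_mul hγ, add_sub_cancel _ _⟩

/-- A sum over all exponents has the same shape as `coeff_deriv`, so that products and derivatives
can be compared term by term and reindexed by translations. -/
theorem coeff_mul_eq_finsum (f g : HahnSeries Γ ℝ) (δ : Γ) :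
    (f * g).coeff δ = ∑ᶠ γ, f.coeff γ * g.coeff (δ - γ) := by
  rw [HahnSeries.coeff_mul, finsum_eq_sum_of_support_subset (s :=
    (Finset.antidiagonal f.isPWO_support g.isPWO_support δ).image Prod.fst)]
  · rw [Finset.sum_image]
    · refine Finset.sum_congr rfl fun x hx => ?_
      rw [Finset.mem_antidiagonal] at hx
      rw [← hx.2.2, add_sub_cancel_left]
    · intro x hx y hy hxy
      rw [Finset.mem_coe, Finset.mem_antidiagonal] at hx hy
      refine Prod.ext hxy ?_
      have := hx.2.2.trans hy.2.2.symm
      rw [hxy] at this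
      exact add_left_cancel this
  · intro γ hγ
    rw [Finset.coe_image]
    refine ⟨(γ, δ - γ), ?_, rfl⟩
    rw [Finset.mem_coe, Finset.mem_antidiagonal]
    exact ⟨left_ne_zero_of_mul hγ, right_ne_zero_of_mul hγ, add_sub_cancel _ _⟩

/-- The product rule, for the product with a transmonomial. -/
theorem deriv_monomial_mul (lam : Γ →+ GridSeries Γ) (c : Γ) (f : GridSeries Γ) :
    deriv lam (monomial c 1 * f) = monomial c 1 * (deriv lam f + lam c * f) := by
  apply toHahn_injective
  ext δ
  rw [coeff_deriv, map_mul toHahn, map_mul toHahn, toHahn_monomial, HahnSeries.coeff_single_mul,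
    one_mul, map_add toHahn, HahnSeries.coeff_add, map_mul toHahn, mul_comm (toHahn (lam c)),
    coeff_deriv, coeff_mul_eq_finsum, ← finsum_add_distrib (finite_support_coeff_deriv lam f _)
    (finite_support_coeff_mul _ _ _), ← finsum_comp_equiv (Equiv.addRight c)]
  refine finsum_congr fun γ => ?_
  rw [Equiv.coe_addRight, map_add lam, HahnSeries.coeff_single_mul, one_mul, map_add toHahn,
    HahnSeries.coeff_add, add_sub_cancel_right, show δ - (γ + c) = δ - c - γ by abel]
  ring

end Asymptotic

/-! ### The asymptotic couple of all transmonomials, by induction on levels -/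

section Levels

variable {Γ : Type} [AddCommGroup Γ] [LinearOrder Γ] [IsOrderedAddMonoid Γ]

theorem Large.pos_of_isLead {l : Large Γ} {p : Γ} (h : IsLead (toHahn l.toGrid) p)
    (hp : 0 < (toHahn l.toGrid).coeff p) : 0 < l := by
  refine (Large.lt_iff _ _).2 ⟨p, fun δ hδ => ?_, ?_⟩
  · rw [h.2 δ hδ, map_zero, map_zero, HahnSeries.coeff_zero]
  · rwa [map_zero, map_zero, HahnSeries.coeff_zero]

theorem Large.exists_isLead_of_pos {l : Large Γ} (h : 0 < l) :
    ∃ p, IsLead (toHahn l.toGrid) p ∧ 0 < (toHahn l.toGrid).coeff p := by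
  obtain ⟨p, h1, h2⟩ := (Large.lt_iff _ _).1 h
  rw [map_zero, map_zero, HahnSeries.coeff_zero] at h2
  refine ⟨p, ⟨h2.ne', fun b hb => ?_⟩, h2⟩
  rw [← h1 b hb, map_zero, map_zero, HahnSeries.coeff_zero]

theorem Large.exists_isLead_of_ne_zero {l : Large Γ} (h : l ≠ 0) :
    ∃ p, p < 0 ∧ IsLead (toHahn l.toGrid) p := by
  have h0 : l.toGrid ≠ 0 := fun h0 => h (Large.toGrid_injective (h0.trans (map_zero _).symm))
  obtain ⟨p, hp⟩ := exists_isLead (toHahn_ne_zero h0)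
  exact ⟨p, l.neg_of_mem_support p hp.1, hp⟩

/-- A purely large series dominates another one, if it is positive and the other one has no
transmonomials that are at least as large as its leading one. -/
theorem Large.lt_of_isLead {l l' : Large Γ} {p : Γ} (h : IsLead (toHahn l.toGrid) p)
    (hp : 0 < (toHahn l.toGrid).coeff p) (h' : ∀ b ≤ p, (toHahn l'.toGrid).coeff b = 0) :
    l' < l := by
  have hc : ∀ b ≤ p, (toHahn (l - l').toGrid).coeff b = (toHahn l.toGrid).coeff b := by
    intro b hb
    rw [map_sub, map_sub, HahnSeries.coeff_sub, h' b hb, sub_zero]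
  rw [← sub_pos]
  refine Large.pos_of_isLead (p := p) ⟨?_, fun b hb => ?_⟩ ?_
  · rw [hc p le_rfl]
    exact h.1
  · rw [hc b hb.le, h.2 b hb]
  · rwa [hc p le_rfl]

/-- Differentiation respects domination, and `log m ≪ m` for large transmonomials `m`. -/
structure Level.IsRegular (S : Level) : Prop where
  isAsymptotic : IsAsymptotic S.logDeriv
  negLog_coeff : ∀ a < 0, ∀ b ≤ a, (toHahn (S.negLog a).toGrid).coeff b = 0

/-- The logarithmic derivative of `exp (-l)` is `-l'`, and the dominant term of `l'` comes from that
of `l`. -/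
theorem Level.IsRegular.isLead_next {S : Level} (h : S.IsRegular) {l : Large S.Mon} {p : S.Mon}
    (hp : p < 0) (hl : IsLead (toHahn l.toGrid) p) :
    IsLead (toHahn (S.next.logDeriv l)) (S.negLog (p + psi S.logDeriv p) : Large S.Mon) := by
  exact ((h.isAsymptotic.isLead_deriv hl hp.ne).gridMap S.negLog S.negLog_strictMono).neg

theorem Level.IsRegular.next {S : Level} (h : S.IsRegular) : S.next.IsRegular := by
  refine ⟨⟨fun l hl h0 => ?_, fun (l : Large S.Mon) (l' : Large S.Mon) hl hl' => ?_⟩,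
    fun (l : Large S.Mon) hl b hb => ?_⟩
  · obtain ⟨p, hp, hlead⟩ := Large.exists_isLead_of_ne_zero hl
    exact (h.isLead_next hp hlead).ne_zero (by rw [h0, map_zero])
  · obtain ⟨p, hlead, hpos⟩ := Large.exists_isLead_of_pos hl
    obtain ⟨q, hq, hlead'⟩ := Large.exists_isLead_of_ne_zero hl'
    have hp : p < 0 := l.neg_of_mem_support p hlead.1
    have e1 : psi S.next.logDeriv l = S.negLog (p + psi S.logDeriv p) :=
      (h.isLead_next hp hlead).order_eq
    have e2 : psi S.next.logDeriv l' = S.negLog (q + psi S.logDeriv q) :=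
      (h.isLead_next hq hlead').order_eq
    rw [e1, e2]
    change S.negLog (q + psi S.logDeriv q) < l + S.negLog (p + psi S.logDeriv p)
    rcases le_or_gt q p with hqp | hpq
    · have : q + psi S.logDeriv q ≤ p + psi S.logDeriv p := by
        rcases hqp.lt_or_eq with hlt | rfl
        · exact (h.isAsymptotic.add_psi_lt hq.ne hp.ne hlt).le
        · exact le_rfl
      calc S.negLog (q + psi S.logDeriv q) ≤ S.negLog (p + psi S.logDeriv p) :=
            S.negLog_strictMono.monotone this
        _ < l + S.negLog (p + psi S.logDeriv p) := lt_add_of_pos_left _ hl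
    -- With `m` the large transmonomial of exponent `p`, the quotient of the two derivatives costs
    -- at most the factor `m ^ 2`, whose logarithm is `2 log m ≪ m ≍ l`; so `exp (-l)` wins.
    · rw [← sub_lt_iff_lt_add, ← map_sub]
      have h1 := (h.isAsymptotic.psi_sub_psi_lt hp.ne hq.ne hpq).2
      have h2 : q + psi S.logDeriv q - (p + psi S.logDeriv p) ≤ -p + -p := by
        calc q + psi S.logDeriv q - (p + psi S.logDeriv p)
            = (q - p) + (psi S.logDeriv q - psi S.logDeriv p) := by abel
          _ ≤ (q - p) + (q - p) := by gcongr
          _ ≤ -p + -p := by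
            have : q - p ≤ -p := by rw [sub_eq_add_neg]; exact add_le_of_nonpos_left hq.le
            gcongr
      refine (S.negLog_strictMono.monotone h2).trans_lt (Large.lt_of_isLead hlead hpos ?_)
      intro b hb
      rw [map_add, map_neg, map_add, map_add, map_neg, map_neg, HahnSeries.coeff_add,
        HahnSeries.coeff_neg, h.negLog_coeff p hp b hb]
      simp
  · by_contra hne
    have hl : 0 < -l := neg_pos.2 hl
    obtain ⟨p, hlead, hpos⟩ := Large.exists_isLead_of_pos hl
    have hp : p < 0 := (-l).neg_of_mem_support p hlead.1
    -- This is `log m ≪ m` one level up: already the dominant transmonomial of `l`, and hence each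
    -- other one, is dominated by `exp (-l)`.
    have h1 : -S.negLog p < -l := Large.lt_of_isLead hlead hpos fun b hb => by
      rw [map_neg, map_neg, HahnSeries.coeff_neg, h.negLog_coeff p hp b hb, neg_zero]
    change (toHahn (gridMap S.negLog S.negLog_strictMono l.toGrid)).coeff b ≠ 0 at hne
    by_cases hr : b ∈ Set.range S.negLog
    · obtain ⟨q, rfl⟩ := hr
      rw [gridMap_coeff] at hne
      have h2 : p ≤ q := hlead.le (by simpa using hne)
      exact (neg_lt_neg_iff.1 h1).not_ge
        ((S.negLog_strictMono.monotone h2).trans hb)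
    · exact hne (gridMap_coeff_of_notMem _ _ _ hr)

/-- The exponent of `1 / (L₀ L₁ ⋯ Lₖ)`, the derivative of `Lₖ₊₁`. -/
def logDerivExp (k : ℕ) : LogMon := ∑ i ∈ Finset.range (k + 1), logExp i

theorem logDerivExp_strictMono : StrictMono logDerivExp := strictMono_nat_of_lt_succ fun k => by
  rw [logDerivExp, logDerivExp, Finset.sum_range_succ _ (k + 1)]
  exact lt_add_of_pos_right _ (logExp_pos _)

theorem LogMon.exists_first {a : ℕ →₀ ℝ} (ha : LogMon.mk a ≠ 0) :
    ∃ i, (∀ j < i, a j = 0) ∧ a i ≠ 0 := by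
  rcases lt_or_gt_of_ne ha with h | h
  · have h' : 0 < LogMon.mk (-a) := by rw [map_neg]; exact neg_pos.2 h
    obtain ⟨i, h1, h2⟩ := (LogMon.pos_iff _).1 h'
    exact ⟨i, fun j hj => by simpa using h1 j hj, by simpa using (neg_pos.1 h2).ne⟩
  · obtain ⟨i, h1, h2⟩ := (LogMon.pos_iff _).1 h
    exact ⟨i, h1, h2.ne'⟩

theorem coeff_logMonLogDeriv (a : ℕ →₀ ℝ) (γ : LogMon) :
    (toHahn (logMonLogDeriv (.mk a))).coeff γ =
      -a.sum fun k c => (HahnSeries.single (logDerivExp k) c).coeff γ := by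
  let φ : GridSeries LogMon →+ ℝ := (HahnSeries.coeff.addMonoidHom γ).comp
    (toHahn (Γ := LogMon) : GridSeries LogMon →+ HahnSeries LogMon ℝ)
  change φ (logMonLogDeriv (.mk a)) = _
  rw [logMonLogDeriv_mk, map_neg, map_finsuppSum]
  congr 1
  refine Finsupp.sum_congr fun k _ => ?_
  change (HahnSeries.single (0 : LogMon) (a k) *
    HahnSeries.single (logDerivExp k) (1 : ℝ)).coeff γ = _
  rw [HahnSeries.single_mul_single, zero_add, mul_one]

/-- The derivatives `1 / (L₀ ⋯ Lₖ)` of `Lₖ₊₁` decrease with `k`, so the first iterated logarithm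
that occurs decides. -/
theorem isLead_logMonLogDeriv {a : ℕ →₀ ℝ} {i : ℕ} (h : ∀ j < i, a j = 0) (hi : a i ≠ 0) :
    IsLead (toHahn (logMonLogDeriv (.mk a))) (logDerivExp i) := by
  constructor
  · rw [coeff_logMonLogDeriv, Finsupp.sum, Finset.sum_eq_single i]
    · simpa using hi
    · exact fun k _ hk => HahnSeries.coeff_single_of_ne (logDerivExp_strictMono.injective.ne hk.symm)
    · intro h
      simp [Finsupp.notMem_support_iff.1 h]
  · intro b hb
    rw [coeff_logMonLogDeriv, Finsupp.sum, Finset.sum_eq_zero, neg_zero]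
    intro k hk
    refine HahnSeries.coeff_single_of_ne fun hbk => ?_
    rw [hbk, logDerivExp_strictMono.lt_iff_lt] at hb
    exact Finsupp.mem_support_iff.1 hk (h k hb)

theorem Level.zero_isRegular : Level.zero.IsRegular := by
  refine ⟨⟨fun (a : LogMon) ha h0 => ?_, fun (a : LogMon) (b : LogMon) ha hb => ?_⟩,
    fun (a : LogMon) ha (b : LogMon) hb => ?_⟩
  · obtain ⟨a, rfl⟩ := LogMon.mk.surjective a
    obtain ⟨i, h1, h2⟩ := LogMon.exists_first ha
    refine (isLead_logMonLogDeriv h1 h2).ne_zero ?_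
    change logMonLogDeriv (.mk a) = 0 at h0
    rw [h0, map_zero]
  · obtain ⟨a, rfl⟩ := LogMon.mk.surjective a
    obtain ⟨b, rfl⟩ := LogMon.mk.surjective b
    obtain ⟨i, h1, h2⟩ := (LogMon.pos_iff _).1 ha
    obtain ⟨j, h3, h4⟩ := LogMon.exists_first hb
    have e1 : psi Level.zero.logDeriv (LogMon.mk a : LogMon) = logDerivExp i :=
      (isLead_logMonLogDeriv h1 h2.ne').order_eq
    have e2 : psi Level.zero.logDeriv (LogMon.mk b : LogMon) = logDerivExp j :=
      (isLead_logMonLogDeriv h3 h4).order_eq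
    rw [e1, e2]
    change logDerivExp j < LogMon.mk a + logDerivExp i
    rcases le_or_gt j i with hji | hij
    · exact (logDerivExp_strictMono.monotone hji).trans_lt (lt_add_of_pos_left _ ha)
    -- Both sums have the entry `1` at all indices up to `i`; these cancel, and the sign is that of
    -- `a i`.
    · have hs : ∀ k, logDerivExp k =
          LogMon.mk (∑ i ∈ Finset.range (k + 1), Finsupp.single i 1) := fun k => by
        rw [map_sum]; rfl
      have hs' : ∀ k m, m ≤ k →
          (∑ i ∈ Finset.range (k + 1), Finsupp.single i (1 : ℝ)) m = 1 := fun k m hm => by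
        rw [Finsupp.finsetSum_apply, Finset.sum_eq_single m]
        · simp
        · exact fun l _ hl => Finsupp.single_eq_of_ne hl.symm
        · exact fun hn => absurd (Finset.mem_range.2 (Nat.lt_succ_of_le hm)) hn
      rw [← sub_pos, hs, hs, ← map_add, ← map_sub]
      refine (LogMon.pos_iff _).2 ⟨i, fun m hm => ?_, ?_⟩
      · rw [Finsupp.sub_apply, Finsupp.add_apply, hs' i m hm.le, hs' j m (hm.le.trans hij.le),
          h1 m hm, zero_add, sub_self]
      · rwa [Finsupp.sub_apply, Finsupp.add_apply, hs' i i le_rfl, hs' j i hij.le,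
          add_sub_cancel_right]
  · obtain ⟨a, rfl⟩ := LogMon.mk.surjective a
    have h' : 0 < LogMon.mk (-a) := by rw [map_neg]; exact neg_pos.2 ha
    obtain ⟨i, h1, h2⟩ := (LogMon.pos_iff _).1 h'
    change (toHahn (logMonNegLog (.mk a)).toGrid).coeff b = 0
    rw [coeff_logMonNegLog, Finsupp.sum, Finset.sum_eq_zero]
    intro k hk
    refine HahnSeries.coeff_single_of_ne fun hbk => ?_
    have hik : i ≤ k := not_lt.1 fun hki =>
      Finsupp.mem_support_iff.1 hk (by simpa using h1 k hki)
    -- A large monomial that starts with a power of `Lᵢ` dominates `Lᵢ₊₁`, the largest term that its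
    -- logarithm can contain.
    have hlt : LogMon.mk a < -logExp (i + 1) := by
      rw [← sub_pos, sub_eq_add_neg, ← map_neg, logExp, ← map_neg, ← map_add]
      refine (LogMon.pos_iff _).2 ⟨i, fun m hm => ?_, ?_⟩
      · rw [Finsupp.add_apply, h1 m hm, Finsupp.neg_apply,
          Finsupp.single_eq_of_ne (by omega), neg_zero, add_zero]
      · rwa [Finsupp.add_apply, Finsupp.neg_apply, Finsupp.single_eq_of_ne (by omega), neg_zero,
          zero_add]
    have hle : -logExp (i + 1) ≤ -logExp (k + 1) :=
      neg_le_neg (logExp_strictAnti.antitone (Nat.succ_le_succ hik))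
    exact (hlt.trans_le hle).not_ge (hbk ▸ hb)

theorem level_isRegular (n : ℕ) : (level n).IsRegular := by
  induction n with
  | zero => exact Level.zero_isRegular
  | succ n ih => exact ih.next

theorem isLead_logDeriv_ofLevel {n : ℕ} {a : Mon n} (ha : a ≠ 0) :
    IsLead (toHahn (logDeriv (ofLevel n a))) (ofLevel n (psi (level n).logDeriv a)) := by
  rw [logDeriv_ofLevel]
  exact ((level_isRegular n).isAsymptotic.isLead ha).gridMap _ (ofLevel_strictMono n)

/-- Two transmonomials lie in a common level, and the embedding of that level preserves the order
and the dominant terms of logarithmic derivatives. -/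
theorem logDeriv_isAsymptotic : IsAsymptotic logDeriv := by
  refine ⟨fun m hm h0 => ?_, fun m m' hm hm' => ?_⟩
  · obtain ⟨n, a, rfl⟩ := exists_ofLevel m
    have ha : a ≠ 0 := by rintro rfl; exact hm (map_zero _)
    exact (isLead_logDeriv_ofLevel ha).ne_zero (by rw [h0, map_zero])
  · obtain ⟨n, a, b, rfl, rfl⟩ := exists_ofLevel₂ m m'
    have ha : 0 < a := (ofLevel_strictMono n).lt_iff_lt.1 (by rwa [map_zero])
    have hb : b ≠ 0 := by rintro rfl; exact hm' (map_zero _)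
    rw [psi, psi, (isLead_logDeriv_ofLevel ha.ne').order_eq, (isLead_logDeriv_ofLevel hb).order_eq,
      ← map_add]
    exact ofLevel_strictMono n ((level_isRegular n).isAsymptotic.psi_lt a b ha hb)

end Levels

/-! ### Series that are `O(m)` or `o(m)` -/

section Support

variable {Γ : Type} [AddCommGroup Γ] [LinearOrder Γ] [IsOrderedAddMonoid Γ]

/-- The series that are `O(m)`, where `m` is the transmonomial of exponent `a`. -/
def atLeast (a : Γ) : Submodule ℝ (HahnSeries Γ ℝ) where
  carrier := {f | ∀ b < a, f.coeff b = 0}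
  zero_mem' _ _ := rfl
  add_mem' hf hg b hb := by rw [HahnSeries.coeff_add, hf b hb, hg b hb, add_zero]
  smul_mem' c f hf b hb := by rw [HahnSeries.coeff_smul, hf b hb, smul_zero]

/-- The series that are `o(m)`, where `m` is the transmonomial of exponent `a`. -/
def above (a : Γ) : Submodule ℝ (HahnSeries Γ ℝ) where
  carrier := {f | ∀ b ≤ a, f.coeff b = 0}
  zero_mem' _ _ := rfl
  add_mem' hf hg b hb := by rw [HahnSeries.coeff_add, hf b hb, hg b hb, add_zero]
  smul_mem' c f hf b hb := by rw [HahnSeries.coeff_smul, hf b hb, smul_zero]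

theorem above_le_atLeast (a : Γ) : above a ≤ atLeast a := fun _ hf b hb => hf b hb.le

theorem atLeast_le_above {a b : Γ} (h : a < b) : atLeast b ≤ above a :=
  fun _ hf c hc => hf c (hc.trans_lt h)

theorem atLeast_anti {a b : Γ} (h : a ≤ b) : atLeast b ≤ atLeast a :=
  fun _ hf c hc => hf c (hc.trans_le h)

theorem IsLead.mem_atLeast {f : HahnSeries Γ ℝ} {a : Γ} (h : IsLead f a) : f ∈ atLeast a := h.2

theorem IsLead.le_of_mem_atLeast {f : HahnSeries Γ ℝ} {a b : Γ} (h : IsLead f a)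
    (hf : f ∈ atLeast b) : b ≤ a := not_lt.1 fun hlt => h.1 (hf a hlt)

theorem single_mem_atLeast (a : Γ) (c : ℝ) : HahnSeries.single a c ∈ atLeast a :=
  fun _ hb => HahnSeries.coeff_single_of_ne hb.ne

theorem mul_mem_atLeast {f g : HahnSeries Γ ℝ} {a b : Γ} (hf : f ∈ atLeast a)
    (hg : g ∈ atLeast b) : f * g ∈ atLeast (a + b) := by
  intro c hc
  by_contra hne
  obtain ⟨x, hx, y, hy, rfl⟩ := HahnSeries.support_mul_subset hne
  have h1 : a ≤ x := not_lt.1 fun h => hx (hf x h)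
  have h2 : b ≤ y := not_lt.1 fun h => hy (hg y h)
  exact hc.not_ge (add_le_add h1 h2)

theorem mul_mem_above {f g : HahnSeries Γ ℝ} {a b : Γ} (hf : f ∈ atLeast a)
    (hg : g ∈ above b) : f * g ∈ above (a + b) := by
  intro c hc
  by_contra hne
  obtain ⟨x, hx, y, hy, rfl⟩ := HahnSeries.support_mul_subset hne
  have h1 : a ≤ x := not_lt.1 fun h => hx (hf x h)
  have h2 : b < y := not_le.1 fun h => hy (hg y h)
  exact hc.not_gt (add_lt_add_of_le_of_lt h1 h2)

theorem mul_mem_atLeast_of_nonneg {f g : HahnSeries Γ ℝ} {a : Γ} (hf : f ∈ atLeast 0)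
    (hg : g ∈ atLeast a) : f * g ∈ atLeast a := by
  simpa using mul_mem_atLeast hf hg

theorem one_mem_atLeast : (1 : HahnSeries Γ ℝ) ∈ atLeast 0 := single_mem_atLeast 0 1

theorem pow_mem_atLeast_zero {f : HahnSeries Γ ℝ} (hf : f ∈ atLeast 0) (n : ℕ) :
    f ^ n ∈ atLeast 0 := by
  induction n with
  | zero => simpa using one_mem_atLeast
  | succ n ih => rw [pow_succ]; exact mul_mem_atLeast_of_nonneg ih hf

theorem pow_succ_mem_above_zero {f : HahnSeries Γ ℝ} (hf : f ∈ above 0) (n : ℕ) :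
    f ^ (n + 1) ∈ above 0 := by
  rw [pow_succ]
  simpa using mul_mem_above (pow_mem_atLeast_zero (above_le_atLeast 0 hf) n) hf

theorem orderTop_pos_of_mem_above {f : HahnSeries Γ ℝ} (hf : f ∈ above 0) : 0 < f.orderTop := by
  by_cases h : f = 0
  · simp [h]
  · rw [HahnSeries.zero_lt_orderTop_iff h]
    exact not_le.1 fun hle => (isLead_order h).1 (hf _ hle)

theorem hsum_mem_atLeast {ι : Type} {s : HahnSeries.SummableFamily Γ ℝ ι} {a : Γ}
    (h : ∀ i, s i ∈ atLeast a) : s.hsum ∈ atLeast a := fun b hb => by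
  rw [HahnSeries.SummableFamily.coeff_hsum]
  exact finsum_eq_zero_of_forall_eq_zero fun i => h i b hb

theorem hsum_mem_above {ι : Type} {s : HahnSeries.SummableFamily Γ ℝ ι} {a : Γ}
    (h : ∀ i, s i ∈ above a) : s.hsum ∈ above a := fun b hb => by
  rw [HahnSeries.SummableFamily.coeff_hsum]
  exact finsum_eq_zero_of_forall_eq_zero fun i => h i b hb

theorem monomial_mul_monomial (a b : Γ) (r s : ℝ) :
    monomial a r * monomial b s = monomial (a + b) (r * s) := by
  apply toHahn_injective
  rw [map_mul, toHahn_monomial, toHahn_monomial, toHahn_monomial, HahnSeries.single_mul_single]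

theorem monomial_add (a : Γ) (r s : ℝ) : monomial a (r + s) = monomial a r + monomial a s := by
  apply toHahn_injective
  rw [map_add, toHahn_monomial, toHahn_monomial, toHahn_monomial, HahnSeries.single_add]

theorem monomial_neg (a : Γ) (r : ℝ) : monomial a (-r) = -monomial a r := by
  apply toHahn_injective
  rw [map_neg, toHahn_monomial, toHahn_monomial, HahnSeries.single_neg]

theorem monomial_zero_one : monomial (0 : Γ) 1 = 1 := rfl

theorem smul_single_one_mul (a : Γ) (r : ℝ) (f : HahnSeries Γ ℝ) :
    r • (HahnSeries.single a 1 * f) = HahnSeries.single a r * f := by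
  ext b
  rw [HahnSeries.coeff_smul, HahnSeries.coeff_single_mul, HahnSeries.coeff_single_mul, one_mul,
    smul_eq_mul]

theorem isLead_single (a : Γ) {r : ℝ} (hr : r ≠ 0) : IsLead (HahnSeries.single a r) a :=
  ⟨by rwa [HahnSeries.coeff_single_same], single_mem_atLeast a r⟩

end Support

/-! ### Powers of `x` and exponentials -/

section Powers

/-- The exponent of `1 / x`. -/
def invX : Transmonomial := powMon (-1)

theorem invX_eq : invX = ofLogMon (logExp 0) := by
  change -(ofLogMon (LogMon.mk (Finsupp.single 0 (-1)))) = ofLogMon (LogMon.mk (Finsupp.single 0 1))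
  rw [Finsupp.single_neg, map_neg, map_neg, neg_neg]

theorem ofLogMon_strictMono : StrictMono ofLogMon := ofLevel_strictMono 0

theorem expNeg_strictMono : StrictMono expNeg := ofLevel_strictMono 1

theorem logDeriv_powMon (a : ℝ) : logDeriv (powMon a) = monomial invX a := by
  have h : logMonLogDeriv (LogMon.mk (Finsupp.single 0 a)) = -monomial (logExp 0) a := by
    rw [logMonLogDeriv_mk, Finsupp.sum_single_index (by simp), zero_add, Finset.sum_range_one]
    change -(monomial 0 a * monomial (logExp 0) 1) = _
    rw [monomial_mul_monomial, zero_add, mul_one]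
  change logDeriv (-(ofLogMon (LogMon.mk (Finsupp.single 0 a)))) = _
  rw [map_neg]
  change -gridMap (Γ := LogMon) ofLogMon ofLogMon_strictMono (logMonLogDeriv _) = _
  rw [h, map_neg, neg_neg, gridMap_monomial, invX_eq]

theorem logDeriv_expMon (c : ℝ) : logDeriv (expMon c) = monomial 0 c := by
  change logDeriv (-(ofLevel 1 (iterLog 0 c))) = _
  rw [map_neg]
  change -gridMap (Γ := Large LogMon) expNeg expNeg_strictMono
    (-gridMap logMonNegLog logMonNegLog_strictMono
      (deriv logMonLogDeriv (monomial (-logExp 0) c))) = _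
  rw [deriv_monomial, map_neg logMonLogDeriv, logMonLogDeriv_logExp, neg_neg, zero_add,
    Finset.sum_range_one, monomial_mul_monomial, neg_add_cancel, mul_one, gridMap_monomial,
    map_neg, neg_neg, gridMap_monomial, map_zero, map_zero]

theorem invX_pos : 0 < invX := by
  have := powMon_strictAnti (show (-1 : ℝ) < 0 by norm_num)
  rwa [map_zero] at this

theorem psi_invX : psi logDeriv invX = invX := by
  rw [psi, invX, logDeriv_powMon]
  exact (isLead_single invX (by norm_num)).order_eq

theorem powMon_neg_natCast (n : ℕ) : powMon (-n) = n • invX := by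
  rw [invX, ← map_nsmul]
  simp

theorem expMon_neg_one_pos : 0 < expMon (-1) := by
  change 0 < -(expNeg (iterLog 0 (-1)))
  rw [map_neg, map_neg, neg_neg, ← map_zero expNeg]
  refine ofLevel_strictMono 1 (Large.pos_of_isLead (p := -logExp 0) ?_ ?_)
  · exact isLead_single (-logExp 0) one_ne_zero
  · change 0 < (HahnSeries.single (-logExp 0) (1 : ℝ)).coeff (-logExp 0)
    rw [HahnSeries.coeff_single_same]
    exact one_pos

theorem psi_expMon_neg_one : psi logDeriv (expMon (-1)) = 0 := by
  rw [psi, logDeriv_expMon]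
  exact (isLead_single 0 (by norm_num)).order_eq

theorem nsmul_invX_lt {γ : Transmonomial} (hγ : 0 < γ) (h : psi logDeriv γ = 0) (n : ℕ) :
    n • invX < γ :=
  logDeriv_isAsymptotic.nsmul_lt_of_psi_eq_zero invX_pos psi_invX hγ h n

/-- The exponent of `x ^ β * exp (-x)`. -/
def expW (β : ℝ) : Transmonomial := powMon β + expMon (-1)

theorem logDeriv_expW (β : ℝ) : logDeriv (expW β) = monomial invX β + monomial 0 (-1) := by
  rw [expW, map_add, logDeriv_powMon, logDeriv_expMon]

theorem nsmul_invX_lt_expW (β : ℝ) (n : ℕ) : n • invX < expW β := by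
  obtain ⟨m, hm⟩ := exists_nat_ge β
  -- The additional `m ≥ β` powers of `1/x` absorb the factor `x ^ β`.
  have h1 := nsmul_invX_lt expMon_neg_one_pos psi_expMon_neg_one (n + m)
  have h2 : -(m • invX) ≤ powMon β := by
    rw [← powMon_neg_natCast, ← map_neg, neg_neg]
    exact powMon_strictAnti.antitone hm
  calc n • invX = -(m • invX) + (n + m) • invX := by rw [add_smul]; abel
    _ < powMon β + expMon (-1) := add_lt_add_of_le_of_lt h2 h1

theorem expW_pos (β : ℝ) : 0 < expW β := by simpa using nsmul_invX_lt_expW β 0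

theorem toHahn_xpow_neg (n : ℕ) : toHahn (xpow (-n)) = HahnSeries.single invX 1 ^ n := by
  rw [xpow, toHahn_monomial, powMon_neg_natCast, HahnSeries.single_pow, one_pow]

theorem toHahn_xpow_neg_one : toHahn (xpow (-1)) = HahnSeries.single invX 1 := rfl

end Powers

/-! ### The equation in Hahn series, and the difference of two solutions -/

section Equation

/-- The family of the terms `g_{kl} x ^ (-k) f ^ l`. -/
def gFamily (g : ℕ → ℕ → ℝ) (f : HahnSeries Transmonomial ℝ) :
    HahnSeries.SummableFamily Transmonomial ℝ (ℕ × ℕ) :=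
  HahnSeries.SummableFamily.smulFamily (fun p => g p.1 p.2)
    ((HahnSeries.SummableFamily.powers (HahnSeries.single invX 1)).mul
      (HahnSeries.SummableFamily.powers f))

/-- The sum `g(1/x, f)`. -/
def gSum (g : ℕ → ℕ → ℝ) (f : HahnSeries Transmonomial ℝ) : HahnSeries Transmonomial ℝ :=
  (gFamily g f).hsum

theorem invX_mem_above : HahnSeries.single invX (1 : ℝ) ∈ above 0 :=
  atLeast_le_above invX_pos (single_mem_atLeast _ _)

/-- Smallness of `f` is needed because `SummableFamily.powers` consists of the true powers only for
series of positive order. -/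
theorem gFamily_apply (g : ℕ → ℕ → ℝ) {f : HahnSeries Transmonomial ℝ} (hf : f ∈ above 0)
    (p : ℕ × ℕ) :
    gFamily g f p = g p.1 p.2 • (HahnSeries.single invX (1 : ℝ) ^ p.1 * f ^ p.2) := by
  change g p.1 p.2 • (HahnSeries.SummableFamily.powers (HahnSeries.single invX (1 : ℝ)) p.1 *
    HahnSeries.SummableFamily.powers f p.2) = _
  rw [HahnSeries.SummableFamily.powers_of_orderTop_pos (orderTop_pos_of_mem_above hf),
    HahnSeries.SummableFamily.powers_of_orderTop_pos (orderTop_pos_of_mem_above invX_mem_above)]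

theorem pow_invX_mem_atLeast (n : ℕ) :
    HahnSeries.single invX (1 : ℝ) ^ n ∈ atLeast (n • invX) := by
  rw [HahnSeries.single_pow]
  exact single_mem_atLeast _ _

theorem pow_invX_mem_atLeast_zero (n : ℕ) : HahnSeries.single invX (1 : ℝ) ^ n ∈ atLeast 0 :=
  pow_mem_atLeast_zero (above_le_atLeast 0 invX_mem_above) n

variable {g : ℕ → ℕ → ℝ} (hg₀₁ : g 0 1 = 0) (hg₁₁ : g 1 1 = 0)
include hg₀₁ hg₁₁

/-- The terms of the difference of `g(1/x, f)` and `g(1/x, φ)` lie in a submodule, if the parts of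
these terms do that are linear in `f - φ`. -/
theorem gFamily_sub_mem {V : Submodule ℝ (HahnSeries Transmonomial ℝ)}
    {f φ : HahnSeries Transmonomial ℝ} (hf : f ∈ above 0) (hφ : φ ∈ above 0)
    (hlin : ∀ k, HahnSeries.single invX (1 : ℝ) ^ (k + 2) * (f - φ) ∈ V)
    (hf' : ∀ k i j, HahnSeries.single invX (1 : ℝ) ^ k * (f ^ i * φ ^ j * f * (f - φ)) ∈ V)
    (hφ' : ∀ k i, HahnSeries.single invX (1 : ℝ) ^ k * (φ ^ i * φ * (f - φ)) ∈ V)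
    (p : ℕ × ℕ) : (gFamily g f - gFamily g φ) p ∈ V := by
  rw [HahnSeries.SummableFamily.sub_apply, gFamily_apply g hf, gFamily_apply g hφ, ← smul_sub,
    ← mul_sub]
  -- The terms with `l = 0` cancel, and for `l = 1` the conditions on `g` leave only `k ≥ 2`.
  obtain ⟨k, l⟩ := p
  match l with
  | 0 => simp
  | 1 =>
    match k with
    | 0 => simp [hg₀₁]
    | 1 => simp [hg₁₁]
    | k + 2 => simpa using V.smul_mem _ (hlin k)
  | l + 2 =>
    refine V.smul_mem _ ?_
    change HahnSeries.single invX (1 : ℝ) ^ k * (f ^ (l + 2) - φ ^ (l + 2)) ∈ V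
    -- In `f ^ l - φ ^ l = (f - φ) ∑ f ^ i φ ^ (l - 1 - i)`, all summands with `i > 0` contain the
    -- factor `f`, and the one with `i = 0` contains `φ`, as `l ≥ 2`.
    rw [← (Commute.all f φ).mul_geom_sum₂, Finset.sum_range_succ', mul_add, mul_add, Finset.mul_sum,
      Finset.mul_sum]
    refine V.add_mem (V.sum_mem fun i _ => ?_) ?_
    · convert hf' k i (l + 2 - 1 - (i + 1)) using 2
      ring
    · convert hφ' k l using 2
      rw [show l + 2 - 1 - 0 = l + 1 by omega]
      ring

/-- Each term is the product of `f - φ` with one of the small factors `1/x`, `f` and `φ`. -/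
theorem gSum_sub_mem_above {f φ : HahnSeries Transmonomial ℝ} {γ : Transmonomial}
    (hf : f ∈ above 0) (hφ : φ ∈ above 0) (hd : f - φ ∈ atLeast γ) :
    gSum g f - gSum g φ ∈ above γ := by
  rw [gSum, gSum, ← HahnSeries.SummableFamily.hsum_sub]
  have hf0 := above_le_atLeast 0 hf
  have hφ0 := above_le_atLeast 0 hφ
  have key : ∀ a : HahnSeries Transmonomial ℝ, a ∈ above 0 → a * (f - φ) ∈ above γ :=
    fun a ha => by simpa [mul_comm] using mul_mem_above hd ha
  have key2 : ∀ a b : HahnSeries Transmonomial ℝ, a ∈ atLeast 0 → b ∈ above 0 → a * b ∈ above 0 :=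
    fun a b ha hb => by simpa using mul_mem_above ha hb
  refine hsum_mem_above (gFamily_sub_mem hg₀₁ hg₁₁ hf hφ (fun k => ?_) (fun k i j => ?_)
    fun k i => ?_)
  · exact key _ (pow_succ_mem_above_zero invX_mem_above (k + 1))
  · rw [← mul_assoc]
    refine key _ (key2 _ _ (pow_invX_mem_atLeast_zero k) (key2 _ _ ?_ hf))
    exact mul_mem_atLeast_of_nonneg (pow_mem_atLeast_zero hf0 i) (pow_mem_atLeast_zero hφ0 j)
  · rw [← mul_assoc]
    exact key _ (key2 _ _ (pow_invX_mem_atLeast_zero k) (key2 _ _ (pow_mem_atLeast_zero hφ0 i) hφ))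

/-- Each term is the product of `f - φ` with a factor that is `O(x ^ (-2))`: either `x ^ (-2)`
itself, or `f` or `φ`. This gain of two powers drives both the sharp uniqueness statement and the
recursion for the coefficients. -/
theorem gSum_sub_mem_atLeast {f φ : HahnSeries Transmonomial ℝ} {γ : Transmonomial}
    (hf : f ∈ atLeast (2 • invX)) (hφ : φ ∈ atLeast (2 • invX)) (hd : f - φ ∈ atLeast γ) :
    gSum g f - gSum g φ ∈ atLeast (2 • invX + γ) := by
  have h2 : 0 < 2 • invX := nsmul_pos invX_pos two_ne_zero
  rw [gSum, gSum, ← HahnSeries.SummableFamily.hsum_sub]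
  have hf0 := atLeast_anti h2.le hf
  have hφ0 := atLeast_anti h2.le hφ
  refine hsum_mem_atLeast (gFamily_sub_mem hg₀₁ hg₁₁ (atLeast_le_above h2 hf)
    (atLeast_le_above h2 hφ) (fun k => ?_) (fun k i j => ?_) fun k i => ?_)
  · refine mul_mem_atLeast (atLeast_anti ?_ (pow_invX_mem_atLeast (k + 2))) hd
    exact nsmul_le_nsmul_left invX_pos.le (by omega)
  · rw [← mul_assoc]
    refine mul_mem_atLeast (mul_mem_atLeast_of_nonneg (pow_invX_mem_atLeast_zero k)
      (mul_mem_atLeast_of_nonneg ?_ hf)) hd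
    exact mul_mem_atLeast_of_nonneg (pow_mem_atLeast_zero hf0 i) (pow_mem_atLeast_zero hφ0 j)
  · rw [← mul_assoc]
    exact mul_mem_atLeast (mul_mem_atLeast_of_nonneg (pow_invX_mem_atLeast_zero k)
      (mul_mem_atLeast_of_nonneg (pow_mem_atLeast_zero hφ0 i) hφ)) hd

omit hg₀₁ hg₁₁

theorem IsSmall.mem_above {f : Transseries} (hf : IsSmall f) : toHahn f ∈ above 0 := fun b hb => by
  by_contra hne
  exact (hf b hne).not_ge hb

theorem isSmall_of_mem_above {f : Transseries} (hf : toHahn f ∈ above 0) : IsSmall f :=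
  fun b hb => not_le.1 fun h => hb (hf b h)

theorem gFamily_toHahn (g : ℕ → ℕ → ℝ) {f : Transseries} (hf : IsSmall f) (p : ℕ × ℕ) :
    gFamily g (toHahn f) p = toHahn (g p.1 p.2 • (xpow (-p.1) * f ^ p.2)) := by
  rw [gFamily_apply g hf.mem_above, map_smul, map_mul, toHahn_xpow_neg, map_pow]

/-- A summable family is determined by its terms, so the sum in the definition of a solution must be
`gSum`. -/
theorem IsSmallSolution.toHahn_D {β : ℝ} {F₀ : PowerSeries ℝ} {f : Transseries}
    (h : IsSmallSolution β F₀ g f) : toHahn (D f) = toHahn (ofPowerSeries F₀) - toHahn f +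
      β • (HahnSeries.single invX 1 * toHahn f) - gSum g (toHahn f) := by
  obtain ⟨G, ⟨-, s, hs, hG⟩, h2⟩ := h.equation
  have : s = gFamily g (toHahn f) := by
    ext1 p
    rw [hs, gFamily_toHahn g h.small]
  rw [h2, map_sub, map_add, map_sub, map_smul, map_mul, ← hG, this, gSum, toHahn_xpow_neg_one]

theorem isSmallSolution_of_toHahn_D {β : ℝ} {F₀ : PowerSeries ℝ} {f : Transseries}
    (hf : IsSmall f) (hgrid : IsGrid (⋃ p, (gFamily g (toHahn f) p).support))
    (h : toHahn (D f) = toHahn (ofPowerSeries F₀) - toHahn f +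
      β • (HahnSeries.single invX 1 * toHahn f) - gSum g (toHahn f)) :
    IsSmallSolution β F₀ g f := by
  refine ⟨hf, .mk (gSum g (toHahn f))
    (hgrid.mono HahnSeries.SummableFamily.support_hsum_subset), ⟨?_, gFamily g (toHahn f),
      gFamily_toHahn g hf, rfl⟩, ?_⟩
  · simpa only [gFamily_toHahn g hf] using hgrid
  · apply toHahn_injective
    rw [h, map_sub, map_add, map_sub, map_smul, map_mul, toHahn_mk, toHahn_xpow_neg_one]

theorem IsSmallSolution.toHahn_D_sub {β : ℝ} {F₀ : PowerSeries ℝ} {f φ : Transseries}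
    (hf : IsSmallSolution β F₀ g f) (hφ : IsSmallSolution β F₀ g φ) :
    toHahn (D (f - φ)) = -toHahn (f - φ) +
      β • (HahnSeries.single invX 1 * toHahn (f - φ)) -
        (gSum g (toHahn f) - gSum g (toHahn φ)) := by
  rw [map_sub, map_sub, hf.toHahn_D, hφ.toHahn_D, map_sub, mul_sub, smul_sub]
  abel

include hg₀₁ hg₁₁

/-- The difference of two small solutions decays exponentially. -/
theorem IsSmallSolution.lt_isLead_sub {β : ℝ} {F₀ : PowerSeries ℝ} {f φ : Transseries}
    (hf : IsSmallSolution β F₀ g f) (hφ : IsSmallSolution β F₀ g φ) {γ : Transmonomial}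
    (hγ : IsLead (toHahn (f - φ)) γ) (n : ℕ) : n • invX < γ := by
  have hpos : 0 < γ := by
    have : toHahn (f - φ) ∈ above 0 := by
      rw [map_sub]
      exact sub_mem hf.small.mem_above hφ.small.mem_above
    exact not_le.1 fun h => hγ.1 (this γ h)
  refine nsmul_invX_lt hpos ?_ n
  have h1 : IsLead (toHahn (D (f - φ))) (γ + psi logDeriv γ) :=
    logDeriv_isAsymptotic.isLead_deriv hγ hpos.ne'
  -- The derivative of the difference is asymptotic to minus the difference. Its dominant exponent
  -- is thus both `γ` and `γ + psi γ`, whence `psi γ = 0`.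
  have h2 : toHahn (D (f - φ)) + toHahn (f - φ) ∈ above γ := by
    rw [hf.toHahn_D_sub hφ]
    have h3 := gSum_sub_mem_above (γ := γ) hg₀₁ hg₁₁ hf.small.mem_above hφ.small.mem_above
      (by rw [← map_sub]; exact hγ.mem_atLeast)
    have h4 : HahnSeries.single invX (1 : ℝ) * toHahn (f - φ) ∈ above γ := by
      rw [mul_comm]
      simpa using mul_mem_above hγ.mem_atLeast invX_mem_above
    convert sub_mem ((above γ).smul_mem β h4) h3 using 1
    abel
  have h3 : IsLead (toHahn (D (f - φ))) γ := by
    constructor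
    · have := h2 γ le_rfl
      rw [HahnSeries.coeff_add] at this
      intro h0
      rw [h0, zero_add] at this
      exact hγ.1 this
    · intro b hb
      have := h2 b hb.le
      rwa [HahnSeries.coeff_add, hγ.2 b hb, add_zero] at this
  simpa using h1.unique h3

/-- A decay of `O(x ^ (-2))` passes from one small solution to all others, as differences lie beyond
all powers of `1/x`. -/
theorem IsSmallSolution.mem_atLeast {β : ℝ} {F₀ : PowerSeries ℝ} {f φ : Transseries}
    (hf : IsSmallSolution β F₀ g f) (hφ : IsSmallSolution β F₀ g φ)
    (h : toHahn φ ∈ atLeast (2 • invX)) : toHahn f ∈ atLeast (2 • invX) := by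
  have : toHahn (f - φ) ∈ atLeast (2 • invX) := by
    by_cases h0 : toHahn (f - φ) = 0
    · rw [h0]; exact zero_mem _
    · obtain ⟨γ, hγ⟩ := exists_isLead h0
      exact atLeast_anti (hf.lt_isLead_sub hg₀₁ hg₁₁ hφ hγ 2).le hγ.mem_atLeast
  rw [← sub_add_cancel f φ, map_add]
  exact add_mem this h

/-- The difference of two solutions that are `O(x ^ (-2))` is asymptotic to a multiple of
`x ^ β * exp (-x)`. -/
theorem IsSmallSolution.isLead_sub_eq {β : ℝ} {F₀ : PowerSeries ℝ} {f φ : Transseries}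
    (hf : IsSmallSolution β F₀ g f) (hφ : IsSmallSolution β F₀ g φ)
    (hf2 : toHahn f ∈ atLeast (2 • invX)) (hφ2 : toHahn φ ∈ atLeast (2 • invX))
    {γ : Transmonomial} (hγ : IsLead (toHahn (f - φ)) γ) : γ = expW β := by
  by_contra hne
  have hq : γ - expW β ≠ 0 := sub_ne_zero.2 hne
  -- Dividing by the solution `x ^ β e ^ (-x)` of the linear part leaves only the nonlinear
  -- difference in the derivative.
  set u := monomial (-expW β) 1 * (f - φ) with hu
  have hlead : IsLead (toHahn u) (γ - expW β) := by
    have hc : ∀ b, (toHahn u).coeff b = (toHahn (f - φ)).coeff (b + expW β) := fun b => by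
      rw [hu, map_mul, toHahn_monomial, HahnSeries.coeff_single_mul, one_mul, sub_neg_eq_add]
    refine ⟨?_, fun b hb => ?_⟩
    · rw [hc, sub_add_cancel]
      exact hγ.1
    · rw [hc]
      exact hγ.2 _ (lt_sub_iff_add_lt.1 hb)
  have hDu : toHahn (D u) = -(HahnSeries.single (-expW β) 1 *
      (gSum g (toHahn f) - gSum g (toHahn φ))) := by
    have h1 : D u = monomial (-expW β) 1 * (D (f - φ) + logDeriv (-expW β) * (f - φ)) :=
      deriv_monomial_mul logDeriv _ _
    have h2 : toHahn (logDeriv (-expW β)) = 1 - HahnSeries.single invX β := by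
      rw [map_neg, logDeriv_expW, neg_add, ← monomial_neg 0, neg_neg, monomial_zero_one, map_add,
        map_neg, toHahn_monomial, map_one]
      abel
    rw [h1, map_mul, toHahn_monomial, map_add, map_mul, h2, hf.toHahn_D_sub hφ, sub_mul, one_mul,
      smul_single_one_mul]
    have hring : ∀ a b c d : HahnSeries Transmonomial ℝ,
        a * (-b + c - d + (b - c)) = -(a * d) := fun a b c d => by ring
    exact hring _ _ _ _
  have h1 := logDeriv_isAsymptotic.isLead_deriv hlead hq
  have h2 : toHahn (D u) ∈ atLeast (-expW β + (2 • invX + γ)) := by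
    rw [hDu]
    refine neg_mem (mul_mem_atLeast (single_mem_atLeast _ _)
      (gSum_sub_mem_atLeast hg₀₁ hg₁₁ hf2 hφ2 ?_))
    rw [← map_sub]
    exact hγ.mem_atLeast
  have h3 := h1.le_of_mem_atLeast h2
  -- The derivative of the small transmonomial `1/x` is `≍ x ^ (-2)`, so it is dominated by the
  -- logarithmic derivative of every transmonomial other than `1`.
  have h4 := logDeriv_isAsymptotic.psi_lt invX (γ - expW β) invX_pos hq
  rw [psi_invX, ← two_nsmul] at h4
  refine h3.not_gt ?_
  calc γ - expW β + psi logDeriv (γ - expW β) < γ - expW β + 2 • invX := by gcongr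
    _ = -expW β + (2 • invX + γ) := by abel

end Equation

/-! ### Supports in a monoid, and scaling by characters -/

section SupportedIn

variable {Γ : Type} [AddCommGroup Γ] [LinearOrder Γ] [IsOrderedAddMonoid Γ]

/-- The series with all their exponents in a given monoid. -/
def supportedIn (M : AddSubmonoid Γ) : Subalgebra ℝ (HahnSeries Γ ℝ) where
  carrier := {f | ∀ γ, f.coeff γ ≠ 0 → γ ∈ M}
  mul_mem' := by
    intro f g hf hg γ hγ
    obtain ⟨a, ha, b, hb, rfl⟩ := HahnSeries.support_mul_subset hγ
    exact M.add_mem (hf a ha) (hg b hb)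
  add_mem' := by
    intro f g hf hg γ hγ
    by_cases h : f.coeff γ = 0
    · rw [HahnSeries.coeff_add, h, zero_add] at hγ
      exact hg γ hγ
    · exact hf γ h
  algebraMap_mem' r γ hγ := by
    rw [HahnSeries.algebraMap_apply, HahnSeries.C_apply] at hγ
    obtain rfl := HahnSeries.support_single_subset hγ
    exact M.zero_mem

theorem single_mem_supportedIn {M : AddSubmonoid Γ} {a : Γ} (ha : a ∈ M) (r : ℝ) :
    HahnSeries.single a r ∈ supportedIn M := fun γ hγ => by
  obtain rfl := HahnSeries.support_single_subset hγ
  exact ha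

theorem hsum_mem_supportedIn {M : AddSubmonoid Γ} {ι : Type} {s : HahnSeries.SummableFamily Γ ℝ ι}
    (h : ∀ i, s i ∈ supportedIn M) : s.hsum ∈ supportedIn M := fun γ hγ => by
  rw [HahnSeries.SummableFamily.coeff_hsum] at hγ
  obtain ⟨i, hi⟩ := not_forall.1 (mt finsum_eq_zero_of_forall_eq_zero hγ)
  exact h i γ hi

/-- Multiplication of the coefficients of a series with a function of the exponents. -/
def scale (χ : Γ → ℝ) : HahnSeries Γ ℝ →ₗ[ℝ] HahnSeries Γ ℝ where
  toFun f := ⟨fun γ => χ γ * f.coeff γ, f.isPWO_support.mono fun _ h => right_ne_zero_of_mul h⟩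
  map_add' f g := by ext γ; exact mul_add _ _ _
  map_smul' r f := by ext γ; exact mul_left_comm _ _ _

theorem coeff_scale (χ : Γ → ℝ) (f : HahnSeries Γ ℝ) (γ : Γ) :
    (scale χ f).coeff γ = χ γ * f.coeff γ := rfl

theorem scale_mem_supportedIn {M : AddSubmonoid Γ} (χ : Γ → ℝ) {f : HahnSeries Γ ℝ}
    (hf : f ∈ supportedIn M) : scale χ f ∈ supportedIn M :=
  fun γ h => hf γ (right_ne_zero_of_mul h)

/-- Multiplicativity of `χ` on `M` is enough, because only exponents from `M` meet in the product.
-/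
theorem scale_mul {M : AddSubmonoid Γ} {χ : Γ → ℝ} (hχ : ∀ a ∈ M, ∀ b ∈ M, χ (a + b) = χ a * χ b)
    {f g : HahnSeries Γ ℝ} (hf : f ∈ supportedIn M) (hg : g ∈ supportedIn M) :
    scale χ (f * g) = scale χ f * scale χ g := by
  ext δ
  rw [coeff_scale, coeff_mul_eq_finsum, coeff_mul_eq_finsum,
    mul_finsum]
  refine finsum_congr fun γ => ?_
  rw [coeff_scale, coeff_scale]
  by_cases h1 : f.coeff γ = 0
  · simp [h1]
  by_cases h2 : g.coeff (δ - γ) = 0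
  · simp [h2]
  rw [show χ δ = χ γ * χ (δ - γ) by rw [← hχ γ (hf γ h1) _ (hg _ h2), add_sub_cancel]]
  ring

theorem scale_single (χ : Γ → ℝ) (a : Γ) (r : ℝ) :
    scale χ (HahnSeries.single a r) = HahnSeries.single a (χ a * r) := by
  ext γ
  rw [coeff_scale]
  by_cases h : γ = a
  · subst h; simp
  · rw [HahnSeries.coeff_single_of_ne h, HahnSeries.coeff_single_of_ne h, mul_zero]

theorem scale_pow {M : AddSubmonoid Γ} {χ : Γ → ℝ} (h0 : χ 0 = 1)
    (hχ : ∀ a ∈ M, ∀ b ∈ M, χ (a + b) = χ a * χ b)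
    {f : HahnSeries Γ ℝ} (hf : f ∈ supportedIn M) (n : ℕ) : scale χ (f ^ n) = scale χ f ^ n := by
  induction n with
  | zero =>
    rw [pow_zero, pow_zero]
    exact (scale_single χ 0 1).trans (by rw [h0, one_mul]; rfl)
  | succ n ih => rw [pow_succ, pow_succ, scale_mul hχ (pow_mem hf n) hf, ih]

/-- The multiplication of coefficients commutes with differentiation, if the factors are the same
for the transmonomials in the derivative of a transmonomial. -/
theorem scale_deriv {M : AddSubmonoid Γ} {χ : Γ → ℝ} {lam : Γ →+ GridSeries Γ}
    (hχ : ∀ a ∈ M, ∀ b, (toHahn (lam a)).coeff b ≠ 0 → χ (a + b) = χ a)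
    {f f' : GridSeries Γ} (hf : toHahn f ∈ supportedIn M) (h : toHahn f' = scale χ (toHahn f)) :
    toHahn (deriv lam f') = scale χ (toHahn (deriv lam f)) := by
  ext δ
  rw [coeff_scale, coeff_deriv, coeff_deriv, mul_finsum]
  refine finsum_congr fun γ => ?_
  rw [h, coeff_scale]
  by_cases h1 : (toHahn f).coeff γ = 0
  · simp [h1]
  by_cases h2 : (toHahn (lam γ)).coeff (δ - γ) = 0
  · simp [h2]
  rw [← hχ γ (hf γ h1) _ h2, add_sub_cancel]
  ring

end SupportedIn

/-! ### Series in `x ^ β e ^ (-x)` and `1/x` -/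

section Lattice

/-- The exponent of `(x ^ β * exp (-x)) ^ k * x ^ (-j)`. -/
def pos (β : ℝ) (k j : ℕ) : Transmonomial := k • expW β + j • invX

theorem pos_zero_left (β : ℝ) (j : ℕ) : pos β 0 j = j • invX := by rw [pos, zero_smul, zero_add]

theorem pos_one_zero (β : ℝ) : pos β 1 0 = expW β := by rw [pos, one_smul, zero_smul, add_zero]

theorem pos_add (β : ℝ) (k j k' j' : ℕ) : pos β k j + pos β k' j' = pos β (k + k') (j + j') := by
  simp only [pos, add_smul]
  abel

theorem pos_add_invX (β : ℝ) (k j : ℕ) : pos β k j + invX = pos β k (j + 1) := by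
  rw [pos, pos, succ_nsmul, add_assoc]

/-- The order is lexicographic, because one factor `x ^ β e ^ (-x)` is beyond all powers of `1/x`.
Hence any double sequence is the coefficient sequence of a series. -/
theorem pos_lt {β : ℝ} {k j k' j' : ℕ} (h : k < k' ∨ k = k' ∧ j < j') :
    pos β k j < pos β k' j' := by
  rcases h with h | ⟨rfl, h⟩
  · obtain ⟨n, rfl⟩ := Nat.exists_eq_add_of_lt h
    calc pos β k j = k • expW β + j • invX := rfl
      _ < k • expW β + expW β := by gcongr; exact nsmul_invX_lt_expW β j
      _ = k • expW β + expW β + 0 + 0 := by abel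
      _ ≤ k • expW β + expW β + n • expW β + j' • invX :=
        add_le_add (add_le_add le_rfl (nsmul_nonneg (expW_pos β).le _))
          (nsmul_nonneg invX_pos.le _)
      _ = pos β (k + n + 1) j' := by rw [pos, add_smul, add_smul, one_smul]; abel
  · exact add_lt_add_right (nsmul_lt_nsmul_left invX_pos h) _

theorem pos_lt_iff {β : ℝ} {k j k' j' : ℕ} :
    pos β k j < pos β k' j' ↔ k < k' ∨ k = k' ∧ j < j' := by
  refine ⟨fun h => ?_, pos_lt⟩
  by_contra hn
  rcases (by omega : (k' < k ∨ k' = k ∧ j' < j) ∨ (k = k' ∧ j = j')) with h' | ⟨rfl, rfl⟩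
  · exact lt_asymm h (pos_lt h')
  · exact lt_irrefl _ h

theorem pos_inj {β : ℝ} {k j k' j' : ℕ} (h : pos β k j = pos β k' j') : k = k' ∧ j = j' := by
  have h1 : ¬pos β k j < pos β k' j' := h.not_lt
  have h2 : ¬pos β k' j' < pos β k j := h.symm.not_lt
  rw [pos_lt_iff] at h1 h2
  omega

/-- The exponents of the transmonomials `(x ^ β * exp (-x)) ^ k * x ^ (-j)`. -/
def lattice (β : ℝ) : AddSubmonoid Transmonomial where
  carrier := {γ | ∃ k j, γ = pos β k j}
  zero_mem' := ⟨0, 0, by rw [pos_zero_left, zero_smul]⟩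
  add_mem' := by
    rintro _ _ ⟨k, j, rfl⟩ ⟨k', j', rfl⟩
    exact ⟨_, _, pos_add ..⟩

theorem pos_mem_lattice (β : ℝ) (k j : ℕ) : pos β k j ∈ lattice β := ⟨k, j, rfl⟩

theorem invX_mem_lattice (β : ℝ) : invX ∈ lattice β := ⟨0, 1, by rw [pos_zero_left, one_smul]⟩

theorem isGrid_lattice (β : ℝ) : IsGrid (lattice β : Set Transmonomial) := by
  refine ⟨Bool, inferInstance, fun b => if b then expW β else invX, 0, ?_, ?_⟩
  · rintro (_ | _)
    · simpa using invX_pos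
    · simpa using expW_pos β
  · rintro _ ⟨k, j, rfl⟩
    refine ⟨fun b => if b then k else j, fun b => by cases b <;> simp, ?_⟩
    simp [pos]

/-- The exponents of the transmonomials in `ser`, with their order. -/
def posEmb (β : ℝ) : ℕ ×ₗ ℕ ↪o Transmonomial :=
  OrderEmbedding.ofStrictMono (fun p => pos β (ofLex p).1 (ofLex p).2) fun _ _ h =>
    pos_lt (Prod.Lex.lt_iff.1 h)

theorem isPWO_lattice (β : ℝ) : (lattice β : Set Transmonomial).IsPWO := by
  refine ((Set.IsPWO.of_linearOrder (Set.univ : Set (ℕ ×ₗ ℕ))).image_of_monotone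
    (posEmb β).monotone).mono ?_
  rintro _ ⟨k, j, rfl⟩
  exact ⟨toLex (k, j), trivial, rfl⟩

/-- The series `∑ c k j * (x ^ β * exp (-x)) ^ k * x ^ (-j)`. -/
def ser (β : ℝ) (c : ℕ → ℕ → ℝ) : Transseries :=
  .mk (HahnSeries.embDomain (posEmb β) ⟨fun p => c (ofLex p).1 (ofLex p).2,
    Set.IsPWO.of_linearOrder _⟩) ((isGrid_lattice β).mono (by
      refine HahnSeries.support_embDomain_subset.trans ?_
      rintro _ ⟨p, -, rfl⟩
      exact ⟨_, _, rfl⟩))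

theorem coeff_ser (β : ℝ) (c : ℕ → ℕ → ℝ) (k j : ℕ) :
    (toHahn (ser β c)).coeff (pos β k j) = c k j :=
  HahnSeries.embDomain_coeff (f := posEmb β) (a := toLex (k, j))

theorem ser_mem (β : ℝ) (c : ℕ → ℕ → ℝ) : toHahn (ser β c) ∈ supportedIn (lattice β) :=
  fun γ hγ => by
    obtain ⟨p, -, rfl⟩ := HahnSeries.support_embDomain_subset hγ
    exact ⟨_, _, rfl⟩

theorem ext_lattice {β : ℝ} {f φ : HahnSeries Transmonomial ℝ} (hf : f ∈ supportedIn (lattice β))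
    (hφ : φ ∈ supportedIn (lattice β)) (h : ∀ k j, f.coeff (pos β k j) = φ.coeff (pos β k j)) :
    f = φ := by
  ext γ
  by_cases hγ : γ ∈ lattice β
  · obtain ⟨k, j, rfl⟩ := hγ
    exact h k j
  · rw [not_not.1 (mt (hf γ) hγ), not_not.1 (mt (hφ γ) hγ)]

theorem ser_sub_mem_atLeast {β : ℝ} {c c' : ℕ → ℕ → ℝ} {k j : ℕ}
    (h : ∀ k' j', (k' < k ∨ k' = k ∧ j' < j) → c k' j' = c' k' j') :
    toHahn (ser β c) - toHahn (ser β c') ∈ atLeast (pos β k j) := by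
  intro b hb
  by_contra hne
  obtain ⟨k', j', rfl⟩ := sub_mem (ser_mem β c) (ser_mem β c') b hne
  rw [HahnSeries.coeff_sub, coeff_ser, coeff_ser, h k' j' (pos_lt_iff.1 hb), sub_self] at hne
  exact hne rfl

theorem ser_mem_atLeast {β : ℝ} {c : ℕ → ℕ → ℝ} {k j : ℕ}
    (h : ∀ k' j', (k' < k ∨ k' = k ∧ j' < j) → c k' j' = 0) :
    toHahn (ser β c) ∈ atLeast (pos β k j) := by
  intro b hb
  by_contra hne
  obtain ⟨k', j', rfl⟩ := ser_mem β c b hne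
  rw [coeff_ser, h k' j' (pos_lt_iff.1 hb)] at hne
  exact hne rfl

/-- The coefficients of the product with `1 / x`. -/
def shift (c : ℕ → ℕ → ℝ) (k : ℕ) : ℕ → ℝ
  | 0 => 0
  | j + 1 => c k j

theorem invX_mul_ser (β : ℝ) (c : ℕ → ℕ → ℝ) :
    HahnSeries.single invX 1 * toHahn (ser β c) = toHahn (ser β (shift c)) := by
  refine ext_lattice (mul_mem (single_mem_supportedIn (invX_mem_lattice β) 1) (ser_mem β c))
    (ser_mem β _) fun k j => ?_
  rw [HahnSeries.coeff_single_mul, one_mul, coeff_ser]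
  cases j with
  | zero =>
    by_contra hne
    obtain ⟨k', j', h⟩ := ser_mem β c _ hne
    rw [sub_eq_iff_eq_add, pos_add_invX] at h
    exact absurd (pos_inj h).2 (by omega)
  | succ j => rw [← pos_add_invX, add_sub_cancel_right, coeff_ser]; rfl

theorem logDeriv_pos (β : ℝ) (k j : ℕ) :
    logDeriv (pos β k j) = monomial invX (k * β - j) + monomial 0 (-k) := by
  have h : ∀ (n : ℕ) (γ : Transmonomial) (r : ℝ), n • monomial γ r = monomial γ (n * r) := by
    intro n γ r
    apply toHahn_injective
    rw [map_nsmul, toHahn_monomial, toHahn_monomial]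
    ext b
    rw [HahnSeries.coeff_smul]
    by_cases hb : b = γ
    · subst hb; simp
    · simp [HahnSeries.coeff_single_of_ne hb]
  rw [pos, map_add, map_nsmul, map_nsmul, logDeriv_expW, invX, logDeriv_powMon, smul_add, h, h, h,
    sub_eq_add_neg, monomial_add, invX]
  simp only [mul_neg, mul_one]
  abel

theorem coeff_logDeriv_pos (β : ℝ) (k j : ℕ) (γ : Transmonomial) :
    (toHahn (logDeriv (pos β k j))).coeff γ =
      (if γ = invX then k * β - j else 0) + (if γ = 0 then -(k : ℝ) else 0) := by
  rw [logDeriv_pos, map_add, toHahn_monomial, toHahn_monomial, HahnSeries.coeff_add]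
  congr 1
  · split_ifs with h
    · rw [h, HahnSeries.coeff_single_same]
    · exact HahnSeries.coeff_single_of_ne h
  · split_ifs with h
    · rw [h, HahnSeries.coeff_single_same]
    · exact HahnSeries.coeff_single_of_ne h

theorem D_ser (β : ℝ) (c : ℕ → ℕ → ℝ) : toHahn (D (ser β c)) =
    HahnSeries.single invX 1 * toHahn (ser β fun k j => (k * β - j) * c k j) +
      toHahn (ser β fun k j => -(k : ℝ) * c k j) := by
  classical
  ext δ
  rw [D, coeff_deriv, HahnSeries.coeff_add, HahnSeries.coeff_single_mul, one_mul]
  -- Logarithmic derivatives on the lattice involve only `1/x` and `1`, so at most `δ - invX` and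
  -- `δ` contribute to the coefficient at `δ`.
  have h : ∀ γ, (toHahn (ser β c)).coeff γ * (toHahn (logDeriv γ)).coeff (δ - γ) =
      (if γ = δ - invX then (toHahn (ser β fun k j => (k * β - j) * c k j)).coeff γ else 0) +
        (if γ = δ then (toHahn (ser β fun k j => -(k : ℝ) * c k j)).coeff γ else 0) := by
    intro γ
    by_cases hγ : γ ∈ lattice β
    · obtain ⟨k, j, rfl⟩ := hγ
      rw [coeff_logDeriv_pos, coeff_ser, coeff_ser, coeff_ser, mul_add]
      congr 1
      · simp only [show δ - pos β k j = invX ↔ pos β k j = δ - invX by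
          rw [sub_eq_iff_eq_add', eq_sub_iff_add_eq, eq_comm]]
        split_ifs <;> ring
      · simp only [show δ - pos β k j = 0 ↔ pos β k j = δ by rw [sub_eq_zero, eq_comm]]
        split_ifs <;> ring
    · have h0 : ∀ c, (toHahn (ser β c)).coeff γ = 0 := fun c => not_not.1 (mt (ser_mem β c γ) hγ)
      simp [h0]
  rw [finsum_congr h, finsum_add_distrib, finsum_eq_single _ (δ - invX), finsum_eq_single _ δ,
    if_pos rfl, if_pos rfl]
  · exact fun γ hγ => if_neg hγ
  · exact fun γ hγ => if_neg hγ
  · refine (Set.finite_singleton (δ - invX)).subset fun γ hγ => ?_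
    by_contra hn
    exact hγ (if_neg hn)
  · refine (Set.finite_singleton δ).subset fun γ hγ => ?_
    by_contra hn
    exact hγ (if_neg hn)

theorem ofPowerSeries_eq_ser (β : ℝ) (p : PowerSeries ℝ) :
    ofPowerSeries p = ser β fun k j => if k = 0 then PowerSeries.coeff j p else 0 := by
  have hc : ∀ j : ℕ, (toHahn (ofPowerSeries p)).coeff (pos β 0 j) = PowerSeries.coeff j p := by
    intro j
    rw [pos_zero_left, ← powMon_neg_natCast]
    exact (HahnSeries.embDomain_coeff (a := j)).trans HahnSeries.coeff_toPowerSeries_symm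
  have hs : ∀ γ, (toHahn (ofPowerSeries p)).coeff γ ≠ 0 → ∃ j, γ = pos β 0 j := by
    intro γ hγ
    obtain ⟨j, -, rfl⟩ := HahnSeries.support_embDomain_subset hγ
    exact ⟨j, by rw [pos_zero_left, ← powMon_neg_natCast]; rfl⟩
  apply toHahn_injective
  refine ext_lattice (fun γ hγ => ?_) (ser_mem β _) fun k j => ?_
  · obtain ⟨j, rfl⟩ := hs γ hγ
    exact pos_mem_lattice β 0 j
  · rw [coeff_ser]
    split_ifs with hk
    · rw [hk, hc]
    · by_contra hne
      obtain ⟨j', h⟩ := hs _ hne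
      exact hk (pos_inj h).1

theorem monomial_mul_ser (β : ℝ) (k : ℕ) (a : ℕ → ℝ) :
    monomial (k • expW β) 1 * ser β (fun k' j => if k' = 0 then a j else 0) =
      ser β fun k' j => if k' = k then a j else 0 := by
  apply toHahn_injective
  rw [map_mul, toHahn_monomial]
  have hk : k • expW β = pos β k 0 := by rw [pos, zero_smul, add_zero]
  refine ext_lattice (mul_mem (single_mem_supportedIn (hk ▸ pos_mem_lattice β k 0) 1) (ser_mem β _))
    (ser_mem β _) fun k' j => ?_
  rw [HahnSeries.coeff_single_mul, one_mul, coeff_ser]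
  split_ifs with h
  · rw [hk, h, show pos β k j = pos β 0 j + pos β k 0 by rw [pos_add, zero_add, add_zero],
      add_sub_cancel_right, coeff_ser, if_pos rfl]
  · by_contra hne
    obtain ⟨k'', j', h'⟩ := ser_mem β _ _ hne
    rw [h', coeff_ser] at hne
    have hk'' : k'' = 0 := by
      by_contra h0
      exact hne (if_neg h0)
    rw [sub_eq_iff_eq_add, hk, pos_add, hk'', zero_add] at h'
    exact h (pos_inj h').1

theorem xpow_mul_expx (β : ℝ) (k : ℕ) :
    xpow (β * k) * expx (-(k : ℝ)) = monomial (k • expW β) 1 := by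
  rw [xpow, expx, monomial_mul_monomial, one_mul, expW, smul_add, ← map_nsmul, ← map_nsmul]
  simp [mul_comm]

theorem hasFormalSum_ser {ι : Type} (β : ℝ) (c : ι → ℕ → ℕ → ℝ)
    (hc : ∀ k j, (Function.support fun i => c i k j).Finite) :
    HasFormalSum (fun i => ser β (c i)) (ser β fun k j => ∑ᶠ i, c i k j) := by
  have hsub : (⋃ i, (toHahn (ser β (c i))).support) ⊆ lattice β :=
    Set.iUnion_subset fun i γ hγ => ser_mem β (c i) γ hγ
  refine ⟨(isGrid_lattice β).mono hsub, ⟨fun i => toHahn (ser β (c i)),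
    (isPWO_lattice β).mono hsub, fun γ => ?_⟩, fun i => rfl, ?_⟩
  · by_cases hγ : γ ∈ lattice β
    · obtain ⟨k, j, rfl⟩ := hγ
      refine (hc k j).subset fun i hi => ?_
      rwa [Function.mem_support, ← coeff_ser β (c i)]
    · refine Set.finite_empty.subset fun i hi => ?_
      exact hγ (ser_mem β (c i) γ hi)
  · refine ext_lattice (hsum_mem_supportedIn fun i => ser_mem β (c i)) (ser_mem β _) fun k j => ?_
    rw [HahnSeries.SummableFamily.coeff_hsum, coeff_ser]
    exact finsum_congr fun i => coeff_ser β (c i) k j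

end Lattice

/-! ### The formal solution and its one-parameter family -/

section Existence

theorem exists_eq_of_forall_lt {α : Type} [LT α] [WellFoundedLT α] (Φ : (α → ℝ) → α → ℝ)
    (h : ∀ c c' p, (∀ q < p, c q = c' q) → Φ c p = Φ c' p) : ∃ c, Φ c = c := by
  classical
  let c : α → ℝ := WellFoundedLT.fix (motive := fun _ => ℝ) fun p rec =>
    -- The value `0` at the entries not yet constructed is arbitrary; by hypothesis `Φ` does not see
    -- them at `p`.
    Φ (fun q => if hq : q < p then rec q hq else 0) p
  refine ⟨c, funext fun p => ?_⟩
  rw [show c p = Φ (fun q => if q < p then c q else 0) p from WellFoundedLT.fix_eq _ _]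
  exact h _ _ p fun q hq => (if_pos hq).symm

/-- A map of double sequences has a fixed point, if the entries of its values depend on
lexicographically smaller entries only. -/
theorem exists_fixed_double_sequence (Φ : (ℕ → ℕ → ℝ) → ℕ → ℕ → ℝ)
    (h : ∀ c c' k j, (∀ k' j', (k' < k ∨ k' = k ∧ j' < j) → c k' j' = c' k' j') →
      Φ c k j = Φ c' k j) : ∃ c, Φ c = c := by
  obtain ⟨c, hc⟩ := exists_eq_of_forall_lt (α := ℕ ×ₗ ℕ)
    (fun c p => Φ (fun k j => c (toLex (k, j))) (ofLex p).1 (ofLex p).2) fun c c' p hp =>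
      h _ _ _ _ fun k' j' hlt => hp _ (Prod.Lex.lt_iff.2 hlt)
  exact ⟨fun k j => c (toLex (k, j)), funext fun k => funext fun j => congrFun hc (toLex (k, j))⟩

theorem gFamily_mem_supportedIn {M : AddSubmonoid Transmonomial} (hM : invX ∈ M) (g : ℕ → ℕ → ℝ)
    {f : HahnSeries Transmonomial ℝ} (hf : f ∈ above 0) (hfM : f ∈ supportedIn M) (p : ℕ × ℕ) :
    gFamily g f p ∈ supportedIn M := by
  rw [gFamily_apply g hf]
  exact (supportedIn M).smul_mem
    (mul_mem (pow_mem (single_mem_supportedIn hM 1) _) (pow_mem hfM _)) _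

theorem gSum_mem_supportedIn {M : AddSubmonoid Transmonomial} (hM : invX ∈ M) (g : ℕ → ℕ → ℝ)
    {f : HahnSeries Transmonomial ℝ} (hf : f ∈ above 0) (hfM : f ∈ supportedIn M) :
    gSum g f ∈ supportedIn M :=
  hsum_mem_supportedIn (gFamily_mem_supportedIn hM g hf hfM)

theorem gSum_zero {g : ℕ → ℕ → ℝ} (hg : ∀ k, g k 0 = 0) : gSum g 0 = 0 := by
  ext γ
  rw [gSum, HahnSeries.SummableFamily.coeff_hsum, HahnSeries.coeff_zero]
  refine finsum_eq_zero_of_forall_eq_zero fun ⟨k, l⟩ => ?_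
  rw [gFamily_apply g (zero_mem _)]
  cases l <;> simp [hg]

/-- The character is `1` at `1/x`, so it acts on each term of the sum through `f` alone. -/
theorem scale_gSum {M : AddSubmonoid Transmonomial} (hM : invX ∈ M) {χ : Transmonomial → ℝ}
    (h0 : χ 0 = 1) (h1 : χ invX = 1) (hχ : ∀ a ∈ M, ∀ b ∈ M, χ (a + b) = χ a * χ b)
    (g : ℕ → ℕ → ℝ) {f : HahnSeries Transmonomial ℝ} (hf : f ∈ above 0)
    (hfM : f ∈ supportedIn M) : scale χ (gSum g f) = gSum g (scale χ f) := by
  have hf' : scale χ f ∈ above 0 := fun b hb => by rw [coeff_scale, hf b hb, mul_zero]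
  ext γ
  rw [coeff_scale, gSum, gSum, HahnSeries.SummableFamily.coeff_hsum,
    HahnSeries.SummableFamily.coeff_hsum, mul_finsum]
  refine finsum_congr fun p => ?_
  have hz : HahnSeries.single invX (1 : ℝ) ∈ supportedIn M := single_mem_supportedIn hM 1
  rw [gFamily_apply g hf, gFamily_apply g hf', ← coeff_scale, map_smul,
    scale_mul hχ (pow_mem hz _) (pow_mem hfM _), scale_pow h0 hχ hz, scale_pow h0 hχ hfM,
    scale_single, h1, one_mul]

open Classical in
/-- The function that maps the exponent of `(x ^ β * exp (-x)) ^ k * x ^ (-j)` to `C ^ k`. -/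
def powChar (β C : ℝ) (γ : Transmonomial) : ℝ :=
  if h : γ ∈ lattice β then C ^ h.choose else 0

/-- The chosen `k` is the right one, since an exponent of the lattice determines `k` and `j`. -/
theorem powChar_pos (β C : ℝ) (k j : ℕ) : powChar β C (pos β k j) = C ^ k := by
  have h := pos_mem_lattice β k j
  rw [powChar, dif_pos h]
  obtain ⟨j', hj'⟩ := h.choose_spec
  rw [← (pos_inj hj').1]

theorem powChar_zero (β C : ℝ) : powChar β C 0 = 1 := by
  simpa [pos] using powChar_pos β C 0 0

theorem powChar_invX (β C : ℝ) : powChar β C invX = 1 := by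
  simpa [pos] using powChar_pos β C 0 1

theorem powChar_add (β C : ℝ) : ∀ a ∈ lattice β, ∀ b ∈ lattice β,
    powChar β C (a + b) = powChar β C a * powChar β C b := by
  rintro _ ⟨k, j, rfl⟩ _ ⟨k', j', rfl⟩
  rw [pos_add, powChar_pos, powChar_pos, powChar_pos, pow_add]

theorem ser_pow_mul (β C : ℝ) (c : ℕ → ℕ → ℝ) :
    toHahn (ser β fun k j => C ^ k * c k j) = scale (powChar β C) (toHahn (ser β c)) := by
  refine ext_lattice (ser_mem β _) (scale_mem_supportedIn _ (ser_mem β c)) fun k j => ?_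
  rw [coeff_scale, coeff_ser, coeff_ser, powChar_pos]

/-- Differentiation does not change the power `k` of the exponential, so it commutes with the
factors `C ^ k`. -/
theorem D_ser_pow_mul (β C : ℝ) (c : ℕ → ℕ → ℝ) :
    toHahn (D (ser β fun k j => C ^ k * c k j)) = scale (powChar β C) (toHahn (D (ser β c))) := by
  refine scale_deriv ?_ (ser_mem β c) (ser_pow_mul β C c)
  rintro _ ⟨k, j, rfl⟩ b hb
  rw [coeff_logDeriv_pos] at hb
  by_cases h1 : b = invX
  · rw [h1, pos_add_invX, powChar_pos, powChar_pos]
  · by_cases h2 : b = 0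
    · rw [h2, add_zero]
    · simp [h1, h2] at hb

theorem scale_ofPowerSeries (β C : ℝ) (p : PowerSeries ℝ) :
    scale (powChar β C) (toHahn (ofPowerSeries p)) = toHahn (ofPowerSeries p) := by
  rw [ofPowerSeries_eq_ser β, ← ser_pow_mul]
  congr 2
  funext k j
  split_ifs with h
  · rw [h, pow_zero, one_mul]
  · rw [mul_zero]

/-- The coefficients of the formal solution give a one-parameter family of solutions. -/
theorem isSmallSolution_ser {β : ℝ} {F₀ : PowerSeries ℝ} {g : ℕ → ℕ → ℝ} {c : ℕ → ℕ → ℝ}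
    (h2 : toHahn (ser β c) ∈ atLeast (2 • invX))
    (h : toHahn (D (ser β c)) = toHahn (ofPowerSeries F₀) - toHahn (ser β c) +
      β • (HahnSeries.single invX 1 * toHahn (ser β c)) - gSum g (toHahn (ser β c))) (C : ℝ) :
    toHahn (ser β fun k j => C ^ k * c k j) ∈ atLeast (2 • invX) ∧
      IsSmallSolution β F₀ g (ser β fun k j => C ^ k * c k j) := by
  have h2' : toHahn (ser β fun k j => C ^ k * c k j) ∈ atLeast (2 • invX) := fun b hb => by
    rw [ser_pow_mul, coeff_scale, h2 b hb, mul_zero]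
  have hpos : 0 < 2 • invX := nsmul_pos invX_pos two_ne_zero
  have ha := atLeast_le_above hpos h2
  have ha' := atLeast_le_above hpos h2'
  have hM := invX_mem_lattice β
  refine ⟨h2', isSmallSolution_of_toHahn_D (isSmall_of_mem_above ha')
    ((isGrid_lattice β).mono (Set.iUnion_subset fun p γ hγ => ?_)) ?_⟩
  · exact gFamily_mem_supportedIn hM g ha' (ser_mem β _) p γ hγ
  · rw [D_ser_pow_mul, h, map_sub, map_add, map_sub, map_smul, scale_ofPowerSeries,
      scale_mul (powChar_add β C) (single_mem_supportedIn hM 1) (ser_mem β c), scale_single,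
      powChar_invX, one_mul, scale_gSum hM (powChar_zero β C) (powChar_invX β C) (powChar_add β C) g
        ha (ser_mem β c), ser_pow_mul]

/-- The coefficients of series that are `O(x ^ (-2))`. -/
def dropLeading (c : ℕ → ℕ → ℝ) (k j : ℕ) : ℝ := if k = 0 ∧ j < 2 then 0 else c k j

theorem ser_dropLeading_mem (β : ℝ) (c : ℕ → ℕ → ℝ) :
    toHahn (ser β (dropLeading c)) ∈ atLeast (2 • invX) := by
  rw [← pos_zero_left β]
  exact ser_mem_atLeast fun k j h => if_pos (by omega)

/-- The coefficients of `g(1/x, f)`. -/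
def gCoeff (β : ℝ) (g : ℕ → ℕ → ℝ) (c : ℕ → ℕ → ℝ) (k j : ℕ) : ℝ :=
  (gSum g (toHahn (ser β c))).coeff (pos β k j)

section

variable {g : ℕ → ℕ → ℝ} (hg : ∀ k, g k 0 = 0) (hg₀₁ : g 0 1 = 0) (hg₁₁ : g 1 1 = 0)
include hg₀₁ hg₁₁

/-- A difference that starts at `(k, j)` affects the nonlinear part only from `(k, j + 2)` on. For
`k = 1` the recursion needs an index beyond `j`, which this gain allows. -/
theorem gCoeff_congr (β : ℝ) {c c' : ℕ → ℕ → ℝ} {k j : ℕ}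
    (hc : toHahn (ser β c) ∈ atLeast (2 • invX)) (hc' : toHahn (ser β c') ∈ atLeast (2 • invX))
    (h : ∀ k' j', (k' < k ∨ k' = k ∧ j' < j) → c k' j' = c' k' j') {i : ℕ} (hi : i < j + 2) :
    gCoeff β g c k i = gCoeff β g c' k i := by
  have h1 := gSum_sub_mem_atLeast hg₀₁ hg₁₁ hc hc' (ser_sub_mem_atLeast h)
  rw [← pos_zero_left β, pos_add, zero_add, add_comm] at h1
  rw [gCoeff, gCoeff, ← sub_eq_zero, ← HahnSeries.coeff_sub]
  exact h1 _ (pos_lt (Or.inr ⟨rfl, hi⟩))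

include hg

/-- Comparison with the zero series: `g(1/x, f)` is `O(x ^ (-4))` for `f = O(x ^ (-2))`. -/
theorem gCoeff_zero_left (β : ℝ) {c : ℕ → ℕ → ℝ} (hc : toHahn (ser β c) ∈ atLeast (2 • invX))
    {j : ℕ} (hj : j < 4) : gCoeff β g c 0 j = 0 := by
  have h1 := gSum_sub_mem_atLeast (φ := 0) (γ := 2 • invX) hg₀₁ hg₁₁ hc (zero_mem _)
    (by rwa [sub_zero])
  rw [gSum_zero hg, sub_zero, ← pos_zero_left β, pos_add] at h1
  exact h1 _ (pos_lt (Or.inr ⟨rfl, hj⟩))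

omit hg

/-- The solvability condition in the resonant row `k = 1`. Up to `j = 1` that row of `g(1/x, f)`
depends only on the part of `f` without exponentials, and for a power series in `1/x` it is zero. -/
theorem gCoeff_one_left (β : ℝ) {c : ℕ → ℕ → ℝ} (hc : toHahn (ser β c) ∈ atLeast (2 • invX))
    {j : ℕ} (hj : j < 2) : gCoeff β g c 1 j = 0 := by
  set c₀ : ℕ → ℕ → ℝ := fun k j => if k = 0 then c k j else 0 with hc₀
  have hc₀' : toHahn (ser β c₀) ∈ atLeast (2 • invX) := by
    rw [← pos_zero_left β]
    refine ser_mem_atLeast fun k j h => ?_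
    have h0 : c k j = 0 := by
      rw [← coeff_ser β c]
      refine hc _ ?_
      rw [← pos_zero_left β]
      exact pos_lt h
    simp [hc₀, h0]
  rw [gCoeff_congr hg₀₁ hg₁₁ β (c' := c₀) (j := 0) hc hc₀' (fun k' j' h => (if_pos (by omega)).symm)
    (by omega)]
  have hM : invX ∈ AddSubmonoid.multiples invX := AddSubmonoid.mem_multiples invX
  have hser : toHahn (ser β c₀) ∈ supportedIn (AddSubmonoid.multiples invX) := by
    intro γ hγ
    obtain ⟨k, j, rfl⟩ := ser_mem β c₀ γ hγ
    rw [coeff_ser] at hγ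
    have hk : k = 0 := by
      by_contra hk
      exact hγ (if_neg hk)
    exact ⟨j, by rw [hk, pos_zero_left]⟩
  by_contra hne
  obtain ⟨i, hi⟩ := gSum_mem_supportedIn hM g
    (atLeast_le_above (nsmul_pos invX_pos two_ne_zero) hc₀') hser _ hne
  change i • invX = _ at hi
  rw [← pos_zero_left β] at hi
  exact absurd (pos_inj hi).1 (by omega)

include hg

/-- The coefficients of the general formal solution. -/
theorem exists_formal_solution (β : ℝ) {F₀ : PowerSeries ℝ} (hF₀ : PowerSeries.coeff 0 F₀ = 0)
    (hF₁ : PowerSeries.coeff 1 F₀ = 0) : ∃ c : ℕ → ℕ → ℝ, c 0 0 = 0 ∧ c 0 1 = 0 ∧ c 1 0 = 1 ∧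
      toHahn (ser β c) ∈ atLeast (2 • invX) ∧
      toHahn (D (ser β c)) = toHahn (ofPowerSeries F₀) - toHahn (ser β c) +
        β • (HahnSeries.single invX 1 * toHahn (ser β c)) - gSum g (toHahn (ser β c)) := by
  -- The equation solved for `c k j`. In the row `k = 1` the entry comes from the equation at `(1, j
  -- + 1)`, as the one at `(1, j)` does not contain it, and `c 1 0 = 1` is a normalization. With
  -- `dropLeading`, the nonlinear part is only evaluated at series that are `O(x ^ (-2))`; at the
  -- fixed point it changes nothing.
  let Φ : (ℕ → ℕ → ℝ) → ℕ → ℕ → ℝ := fun c k j =>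
    if k = 0 ∧ j < 2 then 0
    else if k = 1 then if j = 0 then 1 else gCoeff β g (dropLeading c) 1 (j + 1) / j
    else ((if k = 0 then PowerSeries.coeff j F₀ else 0) +
      ((j - 1) + (1 - k) * β) * shift c k j - gCoeff β g (dropLeading c) k j) / (1 - k)
  obtain ⟨c, hc⟩ := exists_fixed_double_sequence Φ (by
    intro c c' k j h
    have hd : ∀ k' j', (k' < k ∨ k' = k ∧ j' < j) → dropLeading c k' j' = dropLeading c' k' j' :=
      fun k' j' h' => by rw [dropLeading, dropLeading, h k' j' h']
    have hG : ∀ i < j + 2,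
        gCoeff β g (dropLeading c) k i = gCoeff β g (dropLeading c') k i := fun i hi =>
      gCoeff_congr hg₀₁ hg₁₁ β (ser_dropLeading_mem β c) (ser_dropLeading_mem β c') hd hi
    have hs : shift c k j = shift c' k j := by
      cases j with
      | zero => rfl
      | succ j => exact h k j (by omega)
    simp only [Φ]
    rw [hs, hG j (by omega)]
    by_cases hk : k = 1
    · subst hk
      rw [hG (j + 1) (by omega)]
    · simp [hk])
  have hc' : ∀ k j, c k j = Φ c k j := fun k j => by rw [hc]
  have h0 : ∀ j < 2, c 0 j = 0 := fun j hj => by rw [hc']; exact if_pos ⟨rfl, hj⟩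
  have hdrop : dropLeading c = c := by
    funext k j
    rw [dropLeading]
    split_ifs with h
    · rw [h.1, h0 j h.2]
    · rfl
  have h2 : toHahn (ser β c) ∈ atLeast (2 • invX) := hdrop ▸ ser_dropLeading_mem β c
  have h10 : c 1 0 = 1 := by rw [hc']; simp [Φ]
  have h1 : ∀ j, c 1 (j + 1) = gCoeff β g c 1 (j + 2) / (j + 1) := fun j => by
    rw [hc']; simp [Φ, hdrop]
  have hk : ∀ k j, k ≠ 1 → ¬(k = 0 ∧ j < 2) →
      c k j * (1 - k) = (if k = 0 then PowerSeries.coeff j F₀ else 0) +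
        ((j - 1) + (1 - k) * β) * shift c k j - gCoeff β g c k j := fun k j hk1 hk0 => by
    have hne : (1 - k : ℝ) ≠ 0 := sub_ne_zero.2 fun h => hk1 (by exact_mod_cast h.symm)
    rw [hc']
    simp only [Φ, hdrop]
    rw [if_neg hk0, if_neg hk1, div_mul_cancel₀ _ hne]
  refine ⟨c, h0 0 (by omega), h0 1 (by omega), h10, h2, ?_⟩
  have hpos : 0 < 2 • invX := nsmul_pos invX_pos two_ne_zero
  rw [D_ser, invX_mul_ser, invX_mul_ser, ofPowerSeries_eq_ser β]
  refine ext_lattice (add_mem (ser_mem β _) (ser_mem β _))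
    (sub_mem (add_mem (sub_mem (ser_mem β _) (ser_mem β _))
      ((supportedIn (lattice β)).smul_mem (ser_mem β _) β))
      (gSum_mem_supportedIn (invX_mem_lattice β) g (atLeast_le_above hpos h2) (ser_mem β c)))
    fun k j => ?_
  simp only [HahnSeries.coeff_add, HahnSeries.coeff_sub, HahnSeries.coeff_smul, coeff_ser,
    smul_eq_mul]
  change _ = _ - gCoeff β g c k j
  have hshift : shift (fun k j => ((k : ℝ) * β - j) * c k j) k j =
      (k * β - (j - 1)) * shift c k j := by
    cases j with
    | zero => simp [shift]
    | succ j => simp [shift]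
  rw [hshift]
  by_cases hk1 : k = 1
  · subst hk1
    -- The values `j = 0` and `j = 1` were not used in the construction; there the equation holds by
    -- the solvability condition.
    match j with
    | 0 => rw [gCoeff_one_left hg₀₁ hg₁₁ β h2 (by omega)]; simp [shift]
    | 1 => rw [gCoeff_one_left hg₀₁ hg₁₁ β h2 (by omega)]; simp [shift]; ring
    | j + 2 =>
      have := h1 j
      rw [eq_div_iff (by positivity)] at this
      rw [← this]
      simp [shift]
      ring
  · by_cases hk0 : k = 0 ∧ j < 2
    · obtain ⟨rfl, hj⟩ := hk0
      have hs : shift c 0 j = 0 := by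
        match j with
        | 0 => rfl
        | 1 => exact h0 0 (by omega)
      have hF : PowerSeries.coeff j F₀ = 0 := by
        match j with
        | 0 => exact hF₀
        | 1 => exact hF₁
      rw [hs, h0 j hj, hF, gCoeff_zero_left hg hg₀₁ hg₁₁ β h2 (by omega)]
      simp
    · linear_combination hk k j hk1 hk0

end

/-- No real power of `x` is as small as `x ^ β e ^ (-x)`; so level-zero solutions have the parameter
`0`. -/
theorem IsLevelZero.coeff_expW {β : ℝ} {f : Transseries} (hf : IsLevelZero f) :
    (toHahn f).coeff (expW β) = 0 := by
  by_contra hne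
  obtain ⟨a, ha⟩ := hf _ hne
  obtain ⟨n, hn⟩ := exists_nat_ge (-a)
  have h1 := nsmul_invX_lt_expW β n
  rw [ha, ← powMon_neg_natCast] at h1
  have := powMon_strictAnti.lt_iff_gt.1 h1
  linarith

end Existence

end TS

end


/-! ### The proposition -/

theorem mainTheorem8 (β : ℝ) (F₀ : PowerSeries ℝ) (g : ℕ → ℕ → ℝ)
    (hF₀ : PowerSeries.coeff 0 F₀ = 0) (hF₁ : PowerSeries.coeff 1 F₀ = 0)
    (hg : ∀ k, g k 0 = 0) (hg₀₁ : g 0 1 = 0) (hg₁₁ : g 1 1 = 0) :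
    ∃ (f₀ : PowerSeries ℝ) (f : ℕ+ → PowerSeries ℝ),
      (PowerSeries.coeff 0 f₀ = 0 ∧ PowerSeries.coeff 1 f₀ = 0 ∧
        TS.IsSmallSolution β F₀ g (TS.ofPowerSeries f₀) ∧
        ∀ φ : TS.Transseries, TS.IsLevelZero φ → TS.IsSmallSolution β F₀ g φ →
          φ = TS.ofPowerSeries f₀) ∧
      ∃ δ : ℝ → TS.Transseries,
        (∀ C : ℝ, TS.HasFormalSum
          (fun k : ℕ+ => C ^ (k : ℕ) •
            (TS.xpow (β * (k : ℕ)) * TS.expx (-((k : ℕ) : ℝ)) * TS.ofPowerSeries (f k)))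
          (δ C)) ∧
        Set.BijOn (fun C => TS.ofPowerSeries f₀ + δ C) Set.univ
          {φ | TS.IsSmallSolution β F₀ g φ} := by
  obtain ⟨c, h00, h01, h10, h2, hD⟩ := TS.exists_formal_solution hg hg₀₁ hg₁₁ β hF₀ hF₁
  have hsol := TS.isSmallSolution_ser h2 hD
  set T : ℝ → TS.Transseries := fun C => TS.ser β fun k j => C ^ k * c k j with hT
  have hT1 : ∀ C, (TS.toHahn (T C)).coeff (TS.expW β) = C := fun C => by
    rw [← TS.pos_one_zero, TS.coeff_ser, h10, pow_one, mul_one]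
  -- By `0 ^ 0 = 1`, the parameter `0` keeps exactly the row `k = 0`.
  have hf₀ : TS.ofPowerSeries (PowerSeries.mk (c 0)) = T 0 := by
    rw [TS.ofPowerSeries_eq_ser β, hT]
    congr 1
    funext k j
    split_ifs with hk
    · rw [hk, PowerSeries.coeff_mk, pow_zero, one_mul]
    · rw [zero_pow hk, zero_mul]
  have hsum : ∀ C, TS.ofPowerSeries (PowerSeries.mk (c 0)) +
      TS.ser β (fun k j => if k = 0 then 0 else C ^ k * c k j) = T C := fun C => by
    apply TS.toHahn_injective
    rw [map_add, TS.ofPowerSeries_eq_ser β]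
    refine TS.ext_lattice (add_mem (TS.ser_mem β _) (TS.ser_mem β _)) (TS.ser_mem β _)
      fun k j => ?_
    rw [HahnSeries.coeff_add, TS.coeff_ser, TS.coeff_ser, TS.coeff_ser]
    split_ifs with hk
    · rw [hk, PowerSeries.coeff_mk, pow_zero, one_mul, add_zero]
    · rw [zero_add]
  -- A small solution equals the member of the family with the same coefficient at `x ^ β e ^ (-x)`:
  -- otherwise their difference would have its dominant term there, where it vanishes.
  have hle : ∀ φ, TS.IsSmallSolution β F₀ g φ → ∀ C,
      (TS.toHahn φ).coeff (TS.expW β) = C → φ = T C := by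
    intro φ hφ C hC
    by_contra hne
    obtain ⟨γ, hγ⟩ := TS.exists_isLead (TS.toHahn_ne_zero (sub_ne_zero.2 hne))
    have h3 := hφ.isLead_sub_eq hg₀₁ hg₁₁ (hsol C).2
      (hφ.mem_atLeast hg₀₁ hg₁₁ (hsol 0).2 (hsol 0).1) (hsol C).1 hγ
    rw [h3] at hγ
    exact hγ.1 (by rw [map_sub, HahnSeries.coeff_sub, hC, hT1, sub_self])
  refine ⟨PowerSeries.mk (c 0), fun k => PowerSeries.mk (c k),
    ⟨by rw [PowerSeries.coeff_mk, h00], by rw [PowerSeries.coeff_mk, h01],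
      hf₀ ▸ (hsol 0).2, fun φ hφ hφ' => ?_⟩,
    fun C => TS.ser β fun k j => if k = 0 then 0 else C ^ k * c k j, fun C => ?_, ?_, ?_, ?_⟩
  · rw [hf₀]
    exact hle φ hφ' 0 (TS.IsLevelZero.coeff_expW hφ)
  · have hterm : ∀ k : ℕ+, C ^ (k : ℕ) • (TS.xpow (β * (k : ℕ)) * TS.expx (-((k : ℕ) : ℝ)) *
        TS.ofPowerSeries (PowerSeries.mk (c k))) =
        TS.ser β fun k' j => if k' = (k : ℕ) then C ^ (k : ℕ) * c k j else 0 := fun k => by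
      rw [TS.xpow_mul_expx, TS.ofPowerSeries_eq_ser β]
      simp only [PowerSeries.coeff_mk]
      rw [TS.monomial_mul_ser]
      apply TS.toHahn_injective
      rw [map_smul]
      refine TS.ext_lattice ((TS.supportedIn _).smul_mem (TS.ser_mem β _) _) (TS.ser_mem β _)
        fun k' j => ?_
      rw [HahnSeries.coeff_smul, TS.coeff_ser, TS.coeff_ser, smul_eq_mul, mul_ite, mul_zero]
    simp only [hterm]
    convert TS.hasFormalSum_ser β (fun (k : ℕ+) k' j =>
      if k' = (k : ℕ) then C ^ (k : ℕ) * c k j else 0) (fun k' j => ?_) using 2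
    · funext k' j
      split_ifs with hk
      · rw [finsum_eq_zero_of_forall_eq_zero fun k => if_neg (by have := k.pos; omega)]
      · exact ((finsum_eq_single (fun k : ℕ+ => if k' = (k : ℕ) then C ^ (k : ℕ) * c k j else 0)
          ⟨k', Nat.pos_of_ne_zero hk⟩ fun k hk' => if_neg fun h => hk' (PNat.eq h.symm)).trans
            (if_pos rfl)).symm
    · by_cases hk : k' = 0
      · refine Set.finite_empty.subset fun k hk' => hk' (if_neg ?_)
        have := k.pos
        omega
      · refine (Set.finite_singleton (⟨k', Nat.pos_of_ne_zero hk⟩ : ℕ+)).subset fun k hk' => ?_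
        by_contra hn
        exact hk' (if_neg fun h => hn (PNat.eq h.symm))
  · intro C _
    change TS.IsSmallSolution β F₀ g (TS.ofPowerSeries _ + _)
    rw [hsum]
    exact (hsol C).2
  · intro C _ C' _ h
    change TS.ofPowerSeries _ + _ = TS.ofPowerSeries _ + _ at h
    rw [hsum, hsum] at h
    rw [← hT1 C, h, hT1]
  · intro φ hφ
    exact ⟨_, trivial, (hsum _).trans (hle φ hφ _ rfl).symm⟩
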